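/- Identify reals with subsets of $\omega$, let $\leq_T$ be Turing reducibility, let $\mathcal D$ be the set of Turing degrees $\mathbf{x}=\{y \mid y\equiv_T x\}$ of reals $x$, with the order $\mathbf{x}\leq\mathbf{y}$ iff $x\leq_T y$, and let $u_{\mathbf{x}}=\{\mathbf{y}\in\mathcal D \mid \mathbf{y}\geq\mathbf{x}\}$ be the upper cone of $\mathbf{x}$. Turing determinacy ($\mathrm{TD}$) is the assertion that for every set $A\subseteq\mathcal D$, either $A$ or $\mathcal D\setminus A$ contains an upper cone. Proposition. The theory $\mathrm{ZF}+\mathrm{TD}$ (without any form of the axiom of choice) proves: if $\{A_n\}_{n\in\omega}$ is a countable family of countable sets of reals, then $A=\bigcup_{n\in\omega} A_n$ is countable. Equivalently, this assertion is true in every model of $\mathrm{ZF}+\mathrm{TD}$. -/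

import Mathlib

/-- The only symbol of the language of set theory: a binary relation. -/
inductive MemRel : ℕ → Type
  | mem : MemRel 2

/-- The first-order language of set theory. -/
def setLang : FirstOrder.Language.{0, 0} := ⟨fun _ => Empty, MemRel⟩

namespace SetModel

/-- The membership relation of a structure `M` for the language of set theory. Every notion below
is the set-theoretic one evaluated in `M`: all its quantifiers range over `M`, and it speaks about
`M` through `Mem` and equality only. -/
def Mem {M : Type*} [setLang.Structure M] (a b : M) : Prop :=
  FirstOrder.Language.Structure.RelMap (L := setLang) MemRel.mem ![a, b]

infix:50 " ∈ₘ " => Mem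

section

variable {M : Type*} [setLang.Structure M]

/-! ### Natural numbers, ordered pairs, functions -/

/-- `a = ∅` -/
def IsZero (a : M) : Prop := ∀ x, ¬ x ∈ₘ a

/-- `s = a ∪ {a}` -/
def IsSucc (s a : M) : Prop := ∀ x, x ∈ₘ s ↔ x ∈ₘ a ∨ x = a

/-- `a = 1` -/
def IsOne (a : M) : Prop := ∃ z, IsZero z ∧ IsSucc a z

def IsInductive (I : M) : Prop :=
  (∃ z, IsZero z ∧ z ∈ₘ I) ∧ ∀ x, x ∈ₘ I → ∃ s, IsSucc s x ∧ s ∈ₘ I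

/-- `n ∈ ω`, that is, `n` belongs to every inductive set of the model. -/
def IsNat (n : M) : Prop := ∀ I, IsInductive I → n ∈ₘ I

/-- `p = {a, b}` -/
def IsUPair (p a b : M) : Prop := ∀ x, x ∈ₘ p ↔ x = a ∨ x = b

/-- `p` is the Kuratowski pair `(a, b) = {{a}, {a, b}}`. -/
def IsPair (p a b : M) : Prop := ∃ s t, IsUPair s a a ∧ IsUPair t a b ∧ IsUPair p s t

/-- `(a, b) ∈ f` -/
def App (f a b : M) : Prop := ∃ p, IsPair p a b ∧ p ∈ₘ f

/-- `f` is a function from the set `A` to the class `P`. -/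
def IsFunction (f A : M) (P : M → Prop) : Prop :=
  (∀ p, p ∈ₘ f → ∃ a b, a ∈ₘ A ∧ P b ∧ IsPair p a b) ∧ ∀ a, a ∈ₘ A → ∃! b, App f a b

/-- `A` is countable: there is an injection from `A` to `ω`. -/
def IsCountable (A : M) : Prop :=
  ∃ f, IsFunction f A IsNat ∧ ∀ a a' n, App f a n → App f a' n → a = a'

variable (M) in
/-- `M` is a model of ZF. The two schemas run over the relations on `M` that are first-order
definable in the language of set theory with parameters from `M`. -/
structure IsModelOfZF : Prop where
  extensionality : ∀ a b : M, (∀ x, x ∈ₘ a ↔ x ∈ₘ b) → a = b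
  pairing : ∀ a b : M, ∃ c, ∀ x, x ∈ₘ c ↔ x = a ∨ x = b
  union : ∀ a : M, ∃ u, ∀ x, x ∈ₘ u ↔ ∃ y, y ∈ₘ a ∧ x ∈ₘ y
  powerset : ∀ a : M, ∃ p, ∀ x, x ∈ₘ p ↔ ∀ y, y ∈ₘ x → y ∈ₘ a
  infinity : ∃ I : M, IsInductive I
  foundation : ∀ a : M, (∃ x, x ∈ₘ a) → ∃ x, x ∈ₘ a ∧ ∀ y, y ∈ₘ x → ¬ y ∈ₘ a
  separation : ∀ D : Set M, (Set.univ : Set M).Definable₁ setLang D →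
    ∀ a : M, ∃ b, ∀ x, x ∈ₘ b ↔ x ∈ₘ a ∧ x ∈ D
  replacement : ∀ R : Set (M × M), (Set.univ : Set M).Definable₂ setLang R →
    ∀ a : M, (∀ x, x ∈ₘ a → ∃! y, (x, y) ∈ R) →
      ∃ b, ∀ y, y ∈ₘ b ↔ ∃ x, x ∈ₘ a ∧ (x, y) ∈ R

/-! ### Arithmetic on `ω` -/

/-- `f` is a partial function from `ω` to `ω`. -/
def IsPartFun (f : M) : Prop :=
  (∀ p, p ∈ₘ f → ∃ a b, IsNat a ∧ IsNat b ∧ IsPair p a b) ∧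
    ∀ a b b', App f a b → App f a b' → b = b'

/-- `a + b = c`, by recursion on `b`. -/
def IsAdd (a b c : M) : Prop :=
  ∃ f, IsPartFun f ∧ (∀ z, IsZero z → App f z a) ∧
    (∀ n m n' m', App f n m → IsSucc n' n → IsSucc m' m → App f n' m') ∧ App f b c

/-- `a * b = c`, by recursion on `b`. -/
def IsMul (a b c : M) : Prop :=
  ∃ f, IsPartFun f ∧ (∀ z, IsZero z → App f z z) ∧
    (∀ n m n' m', App f n m → IsSucc n' n → IsAdd m a m' → App f n' m') ∧ App f b c

/-- `⟨a, b⟩ = c` for the pairing bijection of `ω` used by `Nat.pair`: `⟨a, b⟩` is `b * b + a` if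
`a < b` and `a * a + a + b` otherwise. -/
def IsNatPair (a b c : M) : Prop :=
  IsNat a ∧ IsNat b ∧ IsNat c ∧
    ((a ∈ₘ b ∧ ∃ s, IsMul b b s ∧ IsAdd s a c) ∨
      (¬ a ∈ₘ b ∧ ∃ s t, IsMul a a s ∧ IsAdd s a t ∧ IsAdd t b c))

/-! ### Relative recursiveness -/

/-- The set `C` contains the partial functions zero, successor, the two projections and the
oracle `o`, and is closed under pairing, composition, primitive recursion and minimization
(the clauses are those of `Nat.RecursiveIn`). -/
structure IsRecClosed (o C : M) : Prop where
  zero : ∀ h, IsPartFun h → (∀ a b, App h a b ↔ IsNat a ∧ IsZero b) → h ∈ₘ C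
  succ : ∀ h, IsPartFun h → (∀ a b, App h a b ↔ IsNat a ∧ IsSucc b a) → h ∈ₘ C
  left : ∀ h, IsPartFun h → (∀ p b, App h p b ↔ ∃ c, IsNatPair b c p) → h ∈ₘ C
  right : ∀ h, IsPartFun h → (∀ p c, App h p c ↔ ∃ b, IsNatPair b c p) → h ∈ₘ C
  oracle : o ∈ₘ C
  pair : ∀ f g h, f ∈ₘ C → g ∈ₘ C → IsPartFun h →
    (∀ a d, App h a d ↔ ∃ b c, App f a b ∧ App g a c ∧ IsNatPair b c d) → h ∈ₘ C
  comp : ∀ f g h, f ∈ₘ C → g ∈ₘ C → IsPartFun h →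
    (∀ a c, App h a c ↔ ∃ b, App g a b ∧ App f b c) → h ∈ₘ C
  /-- `h⟨a, 0⟩ ≃ f(a)` and `h⟨a, n + 1⟩ ≃ g⟨a, ⟨n, h⟨a, n⟩⟩⟩` -/
  prec : ∀ f g h, f ∈ₘ C → g ∈ₘ C → IsPartFun h →
    (∀ a z p, IsZero z → IsNatPair a z p → ∀ b, App h p b ↔ App f a b) →
    (∀ a n n' p p', IsSucc n' n → IsNatPair a n p → IsNatPair a n' p' → ∀ b,
      App h p' b ↔ ∃ i q r, App h p i ∧ IsNatPair n i q ∧ IsNatPair a q r ∧ App g r b) →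
    h ∈ₘ C
  /-- `h(a)` is the least `n` with `f⟨a, n⟩ = 0`, provided `f⟨a, m⟩` is defined for all `m < n`. -/
  rfind : ∀ f h, f ∈ₘ C → IsPartFun h →
    (∀ a n, App h a n ↔ (∃ p z, IsNatPair a n p ∧ IsZero z ∧ App f p z) ∧
      ∀ m, m ∈ₘ n → ∃ p k, IsNatPair a m p ∧ App f p k ∧ ¬ IsZero k) →
    h ∈ₘ C

/-- `f` is a partial function from `ω` to `ω` recursive in `o`: it belongs to every set of the
model with the above closure properties. -/
def IsRecursiveIn (o f : M) : Prop := IsPartFun f ∧ ∀ C, IsRecClosed o C → f ∈ₘ C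

/-! ### Reals and Turing degrees -/

/-- `x` is a real, that is, a subset of `ω`. -/
def IsReal (x : M) : Prop := ∀ n, n ∈ₘ x → IsNat n

/-- `f : ω → {0, 1}` is the characteristic function of `x`. -/
def IsCharFun (f x : M) : Prop :=
  IsPartFun f ∧ ∀ n b, App f n b ↔ IsNat n ∧ ((n ∈ₘ x ∧ IsOne b) ∨ (¬ n ∈ₘ x ∧ IsZero b))

/-- `x ≤_T y`, for reals `x` and `y` -/
def TuringLE (x y : M) : Prop := ∃ f g, IsCharFun f x ∧ IsCharFun g y ∧ IsRecursiveIn g f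

/-- `d` is a Turing degree: `d = {y | y ≡_T x}` for some real `x`. -/
def IsDegree (d : M) : Prop :=
  ∃ x, IsReal x ∧ ∀ y, y ∈ₘ d ↔ IsReal y ∧ TuringLE y x ∧ TuringLE x y

/-- The order on Turing degrees. -/
def DegreeLE (d e : M) : Prop := ∃ x y, x ∈ₘ d ∧ y ∈ₘ e ∧ TuringLE x y

variable (M) in
/-- TD holds in `M`: for every set `A` of Turing degrees, `A` or its complement contains an upper
cone of Turing degrees. -/
def TuringDeterminacy : Prop :=
  ∀ A : M, (∀ d, d ∈ₘ A → IsDegree d) →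
    (∃ d, IsDegree d ∧ ∀ e, IsDegree e → DegreeLE d e → e ∈ₘ A) ∨
    (∃ d, IsDegree d ∧ ∀ e, IsDegree e → DegreeLE d e → ¬ e ∈ₘ A)

variable (M) in
/-- The following holds in `M`: for every sequence `F = (A_n)` indexed by `ω` of countable sets of
reals, the union of the `A_n` is countable. -/
def CountableUnionOfCountableSetsOfReals : Prop :=
  ∀ w F : M, (∀ n, n ∈ₘ w ↔ IsNat n) →
    IsFunction F w (fun A => (∀ x, x ∈ₘ A → IsReal x) ∧ IsCountable A) →
    ∃ U, (∀ x, x ∈ₘ U ↔ ∃ n A, App F n A ∧ x ∈ₘ A) ∧ IsCountable U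

end

end SetModel

/-! Consider the following property of a real x: for some m, every member of each A_k with k < m is
recursive in x, some member of A_m is not, and every member of A_m is a limit below x (`LimitBelow`,
which makes it Σ⁰₂ in x). It is invariant under Turing equivalence, so TD makes it constant on the
cone above some real z. If the union were uncountable, it would take both truth values on that cone.

No choice is needed, because the ground sequences are defined from z alone. Every column of g_0 is
z, and g_{m+1} (`extend`) lists the columns of g_m and all reals `forced g_m c`, that is, the sets
determined over g_m by a program and a finite condition. Programs and conditions are natural
numbers, so the whole double sequence is one real. If every A_m consisted of reals forced over g_m,
this real would enumerate the union. Otherwise let m be least such that some y ∈ A_m is not forced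
over g = g_m. For k < m the members of A_k are then columns of g.

Over g there are two upper bounds of its columns, both of the form `interleave g G` with G generic
for countably many requirements (`exists_generic`). In the first (`exists_bound_not_limitBelow`) G
is Cohen generic, and y is not a limit, since otherwise y would be a `forcedLimit`. The property
fails there: a witness k < m contradicts A_k lying below, k = m contradicts the choice of y, and k >
m would put y itself below, hence among the limits. In the second (`exists_bound_limitBelow`)
conditions also promise that certain free bits converge to the bits of an enumeration w of A_m. This
makes all of A_m limits. A single condition promises only finitely many bits of w, which a number u
can code, so y is still not recursive in the bound, or else it would be a `forcedValue`. The
property holds there. Only one enumeration is ever picked, that of A_m.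

The model M may have a nonstandard ω, so induction, recursion and evaluation of programs all take
place inside M and apply only to predicates definable with parameters. `Dfn` and `fun_prop` keep
track of definability. Choice in the metatheory is harmless, since any function chosen there is used
inside M only after its graph has been shown definable. -/

namespace SetModel

open Set FirstOrder

/-! ### Definable maps -/

section Definability

universe u v w v' w'

variable (M : Type u) [setLang.Structure M]

/-- A type whose elements are coded by finite tuples of elements of `M`, with a definable set
of codes. -/
class DefType (Γ : Type v) where
  ι : Type
  finite : Finite ι
  emb : Γ → ι → M
  inj : Function.Injective emb
  range : (univ : Set M).Definable setLang (Set.range emb)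

attribute [instance] DefType.finite

/-- A map is definable if its graph is first-order definable with parameters. -/
@[fun_prop]
def Dfn {Γ : Type v} [DefType M Γ] {Δ : Type w} [DefType M Δ] (f : Γ → Δ) : Prop :=
  (univ : Set M).Definable setLang
    {t : DefType.ι M Γ ⊕ DefType.ι M Δ → M |
      ∃ γ, t ∘ Sum.inl = DefType.emb γ ∧ t ∘ Sum.inr = DefType.emb (f γ)}

variable {M}

theorem definable_of_eq {ι : Type} {s t : Set (ι → M)} (h : (univ : Set M).Definable setLang s)
    (e : t = s) : (univ : Set M).Definable setLang t := e ▸ h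

theorem definable_coord_eq {ι : Type} (i j : ι) :
    (univ : Set M).Definable setLang {t : ι → M | t i = t j} := by
  refine ⟨(FirstOrder.Language.var i).equal (FirstOrder.Language.var j), ?_⟩
  ext t
  simp [FirstOrder.Language.Formula.realize_equal]

theorem definable_coord_eq_const {ι : Type} (i : ι) (c : M) :
    (univ : Set M).Definable setLang {t : ι → M | t i = c} := by
  refine ⟨(FirstOrder.Language.var i).equal
    ((setLang.con (⟨c, mem_univ c⟩ : (univ : Set M))).term), ?_⟩
  ext t
  simp [FirstOrder.Language.Formula.realize_equal]

theorem definable_mem {ι : Type} (i j : ι) :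
    (univ : Set M).Definable setLang {t : ι → M | t i ∈ₘ t j} := by
  refine ⟨FirstOrder.Language.Relations.formula₂
    (L := setLang[[(univ : Set M)]]) (Sum.inl MemRel.mem) (FirstOrder.Language.var i)
    (FirstOrder.Language.var j), ?_⟩
  ext t
  rw [mem_ofPred_eq, mem_ofPred_eq]
  refine Iff.trans ?_ (FirstOrder.Language.Formula.realize_rel₂
    (L := setLang[[(univ : Set M)]]) (M := M) (R := Sum.inl MemRel.mem)).symm
  simp only [Mem, FirstOrder.Language.Term.realize_var]
  exact Iff.of_eq (FirstOrder.Language.withConstants_relMap_sumInl (L := setLang)).symm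

theorem definable_coords_eq {ι κ : Type} [Finite κ] (r s : κ → ι) :
    (univ : Set M).Definable setLang {t : ι → M | t ∘ r = t ∘ s} := by
  have := definable_iInter_of_finite (fun k => definable_coord_eq (M := M) (r k) (s k))
  convert this using 1
  ext t
  simp [funext_iff]

theorem definable_coords_eq_const {ι κ : Type} [Finite κ] (r : κ → ι) (c : κ → M) :
    (univ : Set M).Definable setLang {t : ι → M | t ∘ r = c} := by
  have := definable_iInter_of_finite (fun k => definable_coord_eq_const (M := M) (r k) (c k))
  convert this using 1
  ext t
  simp [funext_iff]

variable {Γ : Type v} [DefType M Γ] {Δ : Type w} [DefType M Δ] {Θ : Type v'} [DefType M Θ]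

instance : DefType M M where
  ι := Unit
  finite := inferInstance
  emb x := fun _ => x
  inj := fun a b h => congrFun h ()
  range := by
    convert definable_univ
    ext t
    simp only [mem_range, mem_univ, iff_true]
    exact ⟨t (), funext fun _ => rfl⟩

instance : DefType M (Γ × Δ) where
  ι := DefType.ι M Γ ⊕ DefType.ι M Δ
  finite := inferInstance
  emb p := Sum.elim (DefType.emb p.1) (DefType.emb p.2)
  inj := fun p q h => by
    have h1 := congrArg (· ∘ Sum.inl) h
    have h2 := congrArg (· ∘ Sum.inr) h
    simp only [Sum.elim_comp_inl, Sum.elim_comp_inr] at h1 h2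
    exact Prod.ext (DefType.inj h1) (DefType.inj h2)
  range := by
    have h1 := (DefType.range (M := M) (Γ := Γ)).preimage_comp (Sum.inl (β := DefType.ι M Δ))
    have h2 := (DefType.range (M := M) (Γ := Δ)).preimage_comp (Sum.inr (α := DefType.ι M Γ))
    convert h1.inter h2 using 1
    ext t
    constructor
    · rintro ⟨p, rfl⟩
      exact ⟨⟨p.1, by simp⟩, ⟨p.2, by simp⟩⟩
    · rintro ⟨⟨a, ha⟩, ⟨b, hb⟩⟩
      exact ⟨(a, b), by simp only [ha, hb]; exact Sum.elim_comp_inl_inr t⟩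

/-- Projections and coercions only permute or forget coordinates of codes, so their graphs are given
by equations between coordinates. -/
theorem Dfn.of_reindex {f : Γ → Δ} (r : DefType.ι M Δ → DefType.ι M Γ)
    (h : ∀ γ, (DefType.emb (f γ) : _ → M) = DefType.emb γ ∘ r) : Dfn M f := by
  have h1 := (DefType.range (M := M) (Γ := Γ)).preimage_comp (Sum.inl (β := DefType.ι M Δ))
  have h2 := definable_coords_eq (M := M) (Sum.inr (α := DefType.ι M Γ) (β := DefType.ι M Δ))
    (Sum.inl ∘ r)
  refine definable_of_eq (h1.inter h2) ?_
  ext t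
  constructor
  · rintro ⟨γ, h3, h4⟩
    refine ⟨⟨γ, h3.symm⟩, ?_⟩
    rw [mem_ofPred_eq, h4, h, ← Function.comp_assoc, h3]
  · rintro ⟨⟨γ, h3⟩, h4⟩
    refine ⟨γ, h3.symm, ?_⟩
    rw [mem_ofPred_eq, ← Function.comp_assoc] at h4
    rw [h4, h, h3]

@[fun_prop]
theorem Dfn.id : Dfn M (fun x : Γ => x) := Dfn.of_reindex _root_.id fun _ => rfl

@[fun_prop]
theorem Dfn.fst : Dfn M (fun x : Γ × Δ => x.1) := Dfn.of_reindex Sum.inl fun _ => rfl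

@[fun_prop]
theorem Dfn.snd : Dfn M (fun x : Γ × Δ => x.2) := Dfn.of_reindex Sum.inr fun _ => rfl

@[fun_prop]
theorem Dfn.const (b : Δ) : Dfn M (fun _ : Γ => b) := by
  have h1 := (DefType.range (M := M) (Γ := Γ)).preimage_comp (Sum.inl (β := DefType.ι M Δ))
  have h2 := definable_coords_eq_const (M := M) (Sum.inr (α := DefType.ι M Γ)
    (β := DefType.ι M Δ)) (DefType.emb b)
  refine definable_of_eq (h1.inter h2) ?_
  ext t
  constructor
  · rintro ⟨γ, h3, h4⟩
    exact ⟨⟨γ, h3.symm⟩, h4⟩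
  · rintro ⟨⟨γ, h3⟩, h4⟩
    exact ⟨γ, h3.symm, h4⟩

-- The middle value is existentially quantified: both graphs are pulled back to triples of codes and
-- the result is projected. Injectivity of the coding identifies the two middle values.
@[fun_prop]
theorem Dfn.comp {g : Δ → Θ} {f : Γ → Δ} (hg : Dfn M g) (hf : Dfn M f) :
    Dfn M (fun x => g (f x)) := by
  have h1 := Definable.preimage_comp (M := M) (β := (DefType.ι M Γ ⊕ DefType.ι M Θ) ⊕ DefType.ι M Δ)
    (Sum.elim (Sum.inl ∘ Sum.inl) Sum.inr) hf
  have h2 := Definable.preimage_comp (M := M) (β := (DefType.ι M Γ ⊕ DefType.ι M Θ) ⊕ DefType.ι M Δ)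
    (Sum.elim Sum.inr (Sum.inl ∘ Sum.inr)) hg
  have h3 := (h1.inter h2).image_comp Sum.inl
  refine definable_of_eq h3 ?_
  ext t
  constructor
  · rintro ⟨γ, h4, h5⟩
    refine ⟨Sum.elim t (DefType.emb (f γ)), ⟨⟨γ, h4, rfl⟩, ⟨f γ, rfl, h5⟩⟩, ?_⟩
    exact Sum.elim_comp_inl _ _
  · rintro ⟨s, ⟨⟨γ, h4, h5⟩, ⟨δ, h6, h7⟩⟩, rfl⟩
    have : f γ = δ := DefType.inj (h5.symm.trans h6)
    subst this
    exact ⟨γ, h4, h7⟩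

@[fun_prop]
theorem Dfn.prodMk {f : Γ → Δ} {g : Γ → Θ} (hf : Dfn M f) (hg : Dfn M g) :
    Dfn M (fun x => (f x, g x)) := by
  have h1 := Definable.preimage_comp (M := M) (β := DefType.ι M Γ ⊕ (DefType.ι M Δ ⊕ DefType.ι M Θ))
    (Sum.elim Sum.inl (Sum.inr ∘ Sum.inl)) hf
  have h2 := Definable.preimage_comp (M := M) (β := DefType.ι M Γ ⊕ (DefType.ι M Δ ⊕ DefType.ι M Θ))
    (Sum.elim Sum.inl (Sum.inr ∘ Sum.inr)) hg
  refine definable_of_eq (h1.inter h2) ?_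
  ext t
  constructor
  · rintro ⟨γ, h4, h5⟩
    refine ⟨⟨γ, h4, ?_⟩, ⟨γ, h4, ?_⟩⟩
    · exact congrArg (· ∘ Sum.inl) h5
    · exact congrArg (· ∘ Sum.inr) h5
  · rintro ⟨⟨γ, h4, h5⟩, ⟨γ', h6, h7⟩⟩
    have : γ = γ' := DefType.inj (h4.symm.trans h6)
    subst this
    refine ⟨γ, h4, ?_⟩
    have e : t ∘ Sum.inr = Sum.elim ((t ∘ Sum.inr) ∘ Sum.inl) ((t ∘ Sum.inr) ∘ Sum.inr) :=
      (Sum.elim_comp_inl_inr _).symm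
    rw [e]
    exact congrArg₂ Sum.elim h5 h7

theorem dfn_iff_graph {f : Γ → Δ} :
    Dfn M f ↔ (univ : Set M).Definable setLang
      (DefType.emb '' {p : Γ × Δ | f p.1 = p.2}) := by
  refine iff_of_eq (congrArg ((univ : Set M).Definable setLang) ?_)
  ext t
  constructor
  · rintro ⟨γ, h1, h2⟩
    refine ⟨(γ, f γ), rfl, ?_⟩
    exact (congrArg₂ Sum.elim h1.symm h2.symm).trans (Sum.elim_comp_inl_inr t)
  · rintro ⟨⟨γ, δ⟩, h, rfl⟩
    obtain rfl : f γ = δ := h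
    exact ⟨γ, rfl, rfl⟩

/-! ### Definable predicates, connectives and quantifiers -/

variable [Nontrivial M]

/-- Truth values are coded by two distinct elements. -/
noncomputable instance DefType.prop : DefType M Prop where
  ι := Unit
  finite := inferInstance
  emb p := fun _ =>
    haveI := Classical.propDecidable p
    if p then (exists_pair_ne M).choose else (exists_pair_ne M).choose_spec.choose
  inj := fun p q h => by
    have h1 := congrFun h ()
    have h2 := (exists_pair_ne M).choose_spec.choose_spec
    by_cases hp : p <;> by_cases hq : q <;> simp [hp, hq] at h1 ⊢
    · exact h2 h1
    · exact h2 h1.symm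
  range := by
    classical
    convert (definable_coord_eq_const (M := M) () (exists_pair_ne M).choose).union
      (definable_coord_eq_const (M := M) () (exists_pair_ne M).choose_spec.choose) using 1
    ext t
    constructor
    · rintro ⟨p, rfl⟩
      by_cases hp : p
      · left; simp [hp]
      · right; simp [hp]
    · rintro (h | h)
      · exact ⟨True, funext fun _ => by simpa using h.symm⟩
      · exact ⟨False, funext fun _ => by simpa using h.symm⟩

theorem emb_prop_eq_iff {p q : Prop} :
    (DefType.prop (M := M)).emb p = (DefType.prop (M := M)).emb q ↔ (p ↔ q) :=
  ⟨fun h => by rw [DefType.inj h], fun h => by rw [propext h]⟩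

/-- Links predicates, seen as maps into the two-element coded type of truth values, with ordinary
definable sets. This lets one notion `Dfn` serve for functions and for formulas. -/
theorem dfn_prop_iff {p : Γ → Prop} :
    Dfn M p ↔ (univ : Set M).Definable setLang (DefType.emb '' {γ | p γ}) := by
  constructor
  · intro h
    have h1 := definable_coords_eq_const (M := M) (Sum.inr (α := DefType.ι M Γ)
      (β := (DefType.prop (M := M)).ι)) (DefType.emb True)
    have h2 := (Definable.inter h h1).image_comp Sum.inl
    refine definable_of_eq h2 ?_
    ext t
    constructor
    · rintro ⟨γ, h3, rfl⟩
      refine ⟨Sum.elim (DefType.emb γ) (DefType.emb True), ⟨⟨γ, rfl, ?_⟩, rfl⟩, rfl⟩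
      exact emb_prop_eq_iff.2 (iff_of_true trivial h3)
    · rintro ⟨s, ⟨⟨γ, h4, h5⟩, h6⟩, rfl⟩
      have h7 := emb_prop_eq_iff.1 (h5.symm.trans h6)
      exact ⟨γ, h7.2 trivial, h4.symm⟩
  · intro h
    have h0 := h.compl.inter (DefType.range (M := M) (Γ := Γ))
    have h1 := h.preimage_comp (Sum.inl (β := (DefType.prop (M := M)).ι))
    have h2 := h0.preimage_comp (Sum.inl (β := (DefType.prop (M := M)).ι))
    have h3 := definable_coords_eq_const (M := M) (Sum.inr (α := DefType.ι M Γ)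
      (β := (DefType.prop (M := M)).ι)) (DefType.emb True)
    have h4 := definable_coords_eq_const (M := M) (Sum.inr (α := DefType.ι M Γ)
      (β := (DefType.prop (M := M)).ι)) (DefType.emb False)
    refine definable_of_eq ((h1.inter h3).union (h2.inter h4)) ?_
    ext t
    constructor
    · rintro ⟨γ, h5, h6⟩
      by_cases hp : p γ
      · exact Or.inl ⟨⟨γ, hp, h5.symm⟩, h6.trans (emb_prop_eq_iff.2 (iff_of_true hp trivial))⟩
      · refine Or.inr ⟨⟨?_, ⟨γ, h5.symm⟩⟩, h6.trans (emb_prop_eq_iff.2 (iff_of_false hp id))⟩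
        rintro ⟨γ', h7, h8⟩
        rw [DefType.inj (h8.trans h5)] at h7
        exact hp h7
    · rintro (⟨⟨γ, h5, h6⟩, h7⟩ | ⟨⟨h5, ⟨γ, h6⟩⟩, h7⟩)
      · exact ⟨γ, h6.symm, h7.trans (emb_prop_eq_iff.2 (iff_of_true trivial h5))⟩
      · refine ⟨γ, h6.symm, h7.trans (emb_prop_eq_iff.2 (iff_of_false id fun h8 => ?_))⟩
        exact h5 ⟨γ, h8, h6⟩

/-- The standard route for functions obtained by choice in the metatheory: it suffices to describe
the graph by a formula that does not mention the choice. -/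
theorem Dfn.of_graph {f : Γ → Δ} (h : Dfn M (fun p : Γ × Δ => f p.1 = p.2)) : Dfn M f :=
  dfn_iff_graph.2 (dfn_prop_iff.1 h)

-- The set of pairs satisfying equality is the graph of the identity.
@[fun_prop]
theorem Dfn.eq : Dfn M (fun p : Γ × Γ => p.1 = p.2) :=
  dfn_prop_iff.2 (dfn_iff_graph.1 Dfn.id)

@[fun_prop]
theorem Dfn.and {p q : Γ → Prop} (hp : Dfn M p) (hq : Dfn M q) :
    Dfn M (fun x => p x ∧ q x) := by
  rw [dfn_prop_iff] at *
  convert hp.inter hq using 1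
  rw [← image_inter DefType.inj]
  rfl

@[fun_prop]
theorem Dfn.or {p q : Γ → Prop} (hp : Dfn M p) (hq : Dfn M q) :
    Dfn M (fun x => p x ∨ q x) := by
  rw [dfn_prop_iff] at *
  convert hp.union hq using 1
  rw [← image_union]
  rfl

@[fun_prop]
theorem Dfn.not {p : Γ → Prop} (hp : Dfn M p) : Dfn M (fun x => ¬ p x) := by
  rw [dfn_prop_iff] at *
  convert (DefType.range (M := M) (Γ := Γ)).sdiff hp using 1
  rw [← image_univ, ← image_sdiff DefType.inj]
  congr 1
  ext x
  simp

@[fun_prop]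
theorem Dfn.imp {p q : Γ → Prop} (hp : Dfn M p) (hq : Dfn M q) :
    Dfn M (fun x => p x → q x) := by
  simp only [imp_iff_not_or]
  fun_prop

@[fun_prop]
theorem Dfn.iff {p q : Γ → Prop} (hp : Dfn M p) (hq : Dfn M q) :
    Dfn M (fun x => p x ↔ q x) := by
  simp only [iff_iff_implies_and_implies]
  fun_prop

@[fun_prop]
theorem Dfn.exists {p : Γ → Δ → Prop} (hp : Dfn M (fun x : Γ × Δ => p x.1 x.2)) :
    Dfn M (fun x => ∃ y, p x y) := by
  rw [dfn_prop_iff] at *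
  refine definable_of_eq (hp.image_comp Sum.inl) ?_
  ext t
  constructor
  · rintro ⟨γ, ⟨δ, h⟩, rfl⟩
    exact ⟨DefType.emb (γ, δ), ⟨(γ, δ), h, rfl⟩, rfl⟩
  · rintro ⟨_, ⟨⟨γ, δ⟩, h, rfl⟩, rfl⟩
    exact ⟨γ, ⟨δ, h⟩, rfl⟩

@[fun_prop]
theorem Dfn.forall {p : Γ → Δ → Prop} (hp : Dfn M (fun x : Γ × Δ => p x.1 x.2)) :
    Dfn M (fun x => ∀ y, p x y) := by
  have : (fun x => ∀ y, p x y) = fun x => ¬ ∃ y, ¬ p x y := by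
    funext x
    simp
  rw [this]
  fun_prop

@[fun_prop]
theorem Dfn.mem : Dfn M (fun p : M × M => p.1 ∈ₘ p.2) := by
  rw [dfn_prop_iff]
  refine definable_of_eq (definable_mem (M := M) (Sum.inl () : Unit ⊕ Unit) (Sum.inr ())) ?_
  ext t
  constructor
  · rintro ⟨⟨a, b⟩, h, rfl⟩
    exact h
  · intro h
    exact ⟨(t (Sum.inl ()), t (Sum.inr ())), h, funext fun i => by rcases i with i | i <;> rfl⟩

/-- A definable subtype. -/
@[reducible]
def DefType.subtype {p : Γ → Prop} (hp : Dfn M p) : DefType M {x // p x} where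
  ι := DefType.ι M Γ
  finite := inferInstance
  emb x := DefType.emb x.1
  inj := fun _ _ h => Subtype.ext (DefType.inj h)
  range := by
    convert dfn_prop_iff.1 hp using 1
    ext t
    constructor
    · rintro ⟨x, rfl⟩
      exact ⟨x.1, x.2, rfl⟩
    · rintro ⟨x, h, rfl⟩
      exact ⟨⟨x, h⟩, rfl⟩

end Definability

/-! ### Models of ZF: pairs, functions and `ω` -/

section ZF

variable {M : Type*} [setLang.Structure M]

variable (M) in
/-- `M` is a model of ZF, as a class. -/
class ModelOfZF : Prop where
  out : IsModelOfZF M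

theorem set_ext [ModelOfZF M] {a b : M} (h : ∀ x, x ∈ₘ a ↔ x ∈ₘ b) : a = b :=
  ModelOfZF.out.extensionality a b h

theorem IsUPair.inj {p a b c d : M} (h : IsUPair p a b) (h' : IsUPair p c d) :
    (a = c ∧ b = d) ∨ (a = d ∧ b = c) := by
  have h1 := (h' a).1 ((h a).2 (Or.inl rfl))
  have h2 := (h' b).1 ((h b).2 (Or.inr rfl))
  have h3 := (h c).1 ((h' c).2 (Or.inl rfl))
  have h4 := (h d).1 ((h' d).2 (Or.inr rfl))
  grind

theorem IsPair.inj {p a b c d : M} (h : IsPair p a b) (h' : IsPair p c d) : a = c ∧ b = d := by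
  obtain ⟨s, t, hs, ht, hp⟩ := h
  obtain ⟨s', t', hs', ht', hq⟩ := h'
  rcases hp.inj hq with ⟨rfl, rfl⟩ | ⟨rfl, rfl⟩
  · have h1 := hs.inj hs'
    have h2 := ht.inj ht'
    grind
  · have h1 := hs.inj ht'
    have h2 := ht.inj hs'
    grind

variable (M) in
/-- The natural numbers of the model. -/
def Omega : Type _ := {n : M // IsNat n}

theorem Omega.app_nat {f a b : M}
    (hf : ∀ p, p ∈ₘ f → ∃ a b, IsNat a ∧ IsNat b ∧ IsPair p a b) (h : App f a b) :
    ∃ m n : Omega M, m.1 = a ∧ n.1 = b := by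
  obtain ⟨p, hp, hpf⟩ := h
  obtain ⟨a', b', ha, hb, h'⟩ := hf p hpf
  obtain ⟨rfl, rfl⟩ := hp.inj h'
  exact ⟨⟨a, ha⟩, ⟨b, hb⟩, rfl, rfl⟩

variable [hM : ModelOfZF M]

instance : Nontrivial M := by
  obtain ⟨I, ⟨z, hz, hzI⟩, -⟩ := hM.out.infinity
  exact ⟨z, I, fun h => hz z (h ▸ hzI)⟩

theorem separation {P : M → Prop} (hP : Dfn M P) (a : M) :
    ∃ b, ∀ x, x ∈ₘ b ↔ x ∈ₘ a ∧ P x := by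
  refine hM.out.separation {x | P x} ?_ a
  have h := (dfn_prop_iff.1 hP).preimage_comp (fun _ : Unit => (0 : Fin 1))
  refine definable_of_eq h ?_
  ext t
  constructor
  · intro h
    exact ⟨t 0, h, rfl⟩
  · rintro ⟨x, hx, h⟩
    have h1 : x = t 0 := congrFun h ()
    exact show P (t 0) from h1 ▸ hx

/-- Foundation applied to {a, b}. Injectivity of the successor rests on this. -/
theorem mem_asymm {a b : M} (h : a ∈ₘ b) : ¬ b ∈ₘ a := by
  intro h'
  obtain ⟨c, hc⟩ := hM.out.pairing a b
  obtain ⟨x, hx, h2⟩ := hM.out.foundation c ⟨a, (hc a).2 (Or.inl rfl)⟩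
  rcases (hc x).1 hx with rfl | rfl
  · exact h2 b h' ((hc b).2 (Or.inr rfl))
  · exact h2 a h ((hc a).2 (Or.inl rfl))

/-! ### Definability and uniqueness of the basic set-theoretic notions -/

@[fun_prop] theorem dfn_isZero : Dfn M (fun x : M => IsZero x) := by
  unfold IsZero; fun_prop

@[fun_prop] theorem dfn_isSucc : Dfn M (fun x : M × M => IsSucc x.1 x.2) := by
  unfold IsSucc; fun_prop

@[fun_prop] theorem dfn_isOne : Dfn M (fun x : M => IsOne x) := by
  unfold IsOne; fun_prop

@[fun_prop] theorem dfn_isInductive : Dfn M (fun x : M => IsInductive x) := by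
  unfold IsInductive; fun_prop

@[fun_prop] theorem dfn_isNat : Dfn M (fun x : M => IsNat x) := by
  unfold IsNat; fun_prop

@[fun_prop] theorem dfn_isUPair : Dfn M (fun x : M × M × M => IsUPair x.1 x.2.1 x.2.2) := by
  unfold IsUPair; fun_prop

@[fun_prop] theorem dfn_isPair : Dfn M (fun x : M × M × M => IsPair x.1 x.2.1 x.2.2) := by
  unfold IsPair; fun_prop

@[fun_prop] theorem dfn_app : Dfn M (fun x : M × M × M => App x.1 x.2.1 x.2.2) := by
  unfold App; fun_prop

@[fun_prop] theorem dfn_isPartFun : Dfn M (fun x : M => IsPartFun x) := by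
  unfold IsPartFun; fun_prop

@[fun_prop] theorem dfn_isAdd : Dfn M (fun x : M × M × M => IsAdd x.1 x.2.1 x.2.2) := by
  unfold IsAdd; fun_prop

@[fun_prop] theorem dfn_isMul : Dfn M (fun x : M × M × M => IsMul x.1 x.2.1 x.2.2) := by
  unfold IsMul; fun_prop

@[fun_prop] theorem dfn_isNatPair :
    Dfn M (fun x : M × M × M => IsNatPair x.1 x.2.1 x.2.2) := by
  unfold IsNatPair; fun_prop

theorem IsZero.eq {a b : M} (ha : IsZero a) (hb : IsZero b) : a = b :=
  set_ext fun x => iff_of_false (ha x) (hb x)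

theorem IsSucc.eq {s t a : M} (hs : IsSucc s a) (ht : IsSucc t a) : s = t :=
  set_ext fun x => (hs x).trans (ht x).symm

theorem IsSucc.inj {s a b : M} (ha : IsSucc s a) (hb : IsSucc s b) : a = b := by
  by_contra h
  have h1 := ((hb a).1 ((ha a).2 (Or.inr rfl))).resolve_right h
  have h2 := ((ha b).1 ((hb b).2 (Or.inr rfl))).resolve_right (Ne.symm h)
  exact mem_asymm h1 h2

theorem exists_isSucc (a : M) : ∃ s, IsSucc s a := by
  obtain ⟨c, hc⟩ := hM.out.pairing a a
  obtain ⟨d, hd⟩ := hM.out.pairing a c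
  obtain ⟨u, hu⟩ := hM.out.union d
  refine ⟨u, fun x => (hu x).trans ⟨?_, ?_⟩⟩
  · rintro ⟨y, hy, hx⟩
    rcases (hd y).1 hy with rfl | rfl
    · exact Or.inl hx
    · exact Or.inr (by simpa using (hc x).1 hx)
  · rintro (hx | rfl)
    · exact ⟨a, (hd a).2 (Or.inl rfl), hx⟩
    · exact ⟨c, (hd c).2 (Or.inr rfl), (hc x).2 (Or.inl rfl)⟩

theorem IsUPair.eq {p q a b : M} (hp : IsUPair p a b) (hq : IsUPair q a b) : p = q :=
  set_ext fun x => (hp x).trans (hq x).symm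

theorem exists_isPair (a b : M) : ∃ p, IsPair p a b := by
  obtain ⟨s, hs⟩ := hM.out.pairing a a
  obtain ⟨t, ht⟩ := hM.out.pairing a b
  obtain ⟨p, hp⟩ := hM.out.pairing s t
  exact ⟨p, s, t, hs, ht, hp⟩

theorem IsPair.eq {p q a b : M} (hp : IsPair p a b) (hq : IsPair q a b) : p = q := by
  obtain ⟨s, t, hs, ht, hp⟩ := hp
  obtain ⟨s', t', hs', ht', hq⟩ := hq
  obtain rfl := hs.eq hs'
  obtain rfl := ht.eq ht'
  exact hp.eq hq

/-- The pairs `(a, b)` with `a ∈ A` and `b ∈ B` satisfying a definable relation form a set. -/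
theorem exists_graph {φ : M → M → Prop} (hφ : Dfn M (fun x : M × M => φ x.1 x.2)) (A B : M) :
    ∃ f : M, (∀ p, p ∈ₘ f → ∃ a b, a ∈ₘ A ∧ b ∈ₘ B ∧ IsPair p a b) ∧
      ∀ a b, App f a b ↔ a ∈ₘ A ∧ b ∈ₘ B ∧ φ a b := by
  obtain ⟨d, hd⟩ := hM.out.pairing A B
  obtain ⟨u, hu⟩ := hM.out.union d
  obtain ⟨v, hv⟩ := hM.out.powerset u
  obtain ⟨w, hw⟩ := hM.out.powerset v
  obtain ⟨f, hf⟩ := separation (M := M)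
    (P := fun p => ∃ a b, a ∈ₘ A ∧ b ∈ₘ B ∧ φ a b ∧ IsPair p a b) (by fun_prop) w
  refine ⟨f, fun p hp => ?_, fun a b => ⟨?_, ?_⟩⟩
  · obtain ⟨a, b, ha, hb, -, h⟩ := ((hf p).1 hp).2
    exact ⟨a, b, ha, hb, h⟩
  · rintro ⟨p, hp, hpf⟩
    obtain ⟨a', b', ha, hb, h, h'⟩ := ((hf p).1 hpf).2
    obtain ⟨rfl, rfl⟩ := hp.inj h'
    exact ⟨ha, hb, h⟩
  · rintro ⟨ha, hb, h⟩
    obtain ⟨p, hp⟩ := exists_isPair a b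
    -- A Kuratowski pair of elements of A and B lies in the double power set of A ∪ B, which bounds
    -- the separation.
    refine ⟨p, hp, (hf p).2 ⟨(hw p).2 fun y hy => (hv y).2 fun x hx => (hu x).2 ?_,
      a, b, ha, hb, h, hp⟩⟩
    obtain ⟨s, t, hs, ht, hp⟩ := hp
    have ha' : ∃ y, y ∈ₘ d ∧ a ∈ₘ y := ⟨A, (hd A).2 (Or.inl rfl), ha⟩
    have hb' : ∃ y, y ∈ₘ d ∧ b ∈ₘ y := ⟨B, (hd B).2 (Or.inr rfl), hb⟩
    rcases (hp y).1 hy with rfl | rfl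
    · rcases (hs x).1 hx with rfl | rfl <;> exact ha'
    · rcases (ht x).1 hx with rfl | rfl
      · exact ha'
      · exact hb'

instance : DefType M (Omega M) := DefType.subtype (p := IsNat) dfn_isNat

@[fun_prop]
theorem Dfn.omegaVal : Dfn M (fun n : Omega M => n.1) := Dfn.of_reindex _root_.id fun _ => rfl

variable (M) in
theorem exists_omega : ∃ w : M, ∀ n, n ∈ₘ w ↔ IsNat n := by
  obtain ⟨I, hI⟩ := hM.out.infinity
  obtain ⟨w, hw⟩ := separation (M := M) (P := IsNat) (by fun_prop) I
  exact ⟨w, fun n => (hw n).trans ⟨fun h => h.2, fun h => ⟨h I hI, h⟩⟩⟩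

theorem IsNat.of_isZero {z : M} (hz : IsZero z) : IsNat z := by
  rintro I ⟨⟨z', hz', h⟩, -⟩
  exact hz.eq hz' ▸ h

theorem IsNat.of_isSucc {n s : M} (hn : IsNat n) (hs : IsSucc s n) : IsNat s := by
  intro I hI
  obtain ⟨s', hs', h⟩ := hI.2 n (hn I hI)
  exact hs.eq hs' ▸ h

variable (M) in
theorem exists_isZero : ∃ z : M, IsZero z := by
  obtain ⟨I, ⟨z, hz, -⟩, -⟩ := hM.out.infinity
  exact ⟨z, hz⟩

/-! ### Induction, iteration, addition and multiplication on the natural numbers of the model -/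

namespace Omega

/-- The empty set as a natural number. -/
@[irreducible] noncomputable def zero : Omega M :=
  ⟨(exists_isZero M).choose, IsNat.of_isZero (exists_isZero M).choose_spec⟩

noncomputable instance : Zero (Omega M) := ⟨zero⟩

/-- The successor of a natural number. -/
@[irreducible] noncomputable def succ (n : Omega M) : Omega M :=
  ⟨(exists_isSucc n.1).choose, n.2.of_isSucc (exists_isSucc n.1).choose_spec⟩

theorem isZero_zero : IsZero (0 : Omega M).1 := by
  change IsZero (zero : Omega M).1
  unfold zero
  exact (exists_isZero M).choose_spec

theorem isSucc_succ (n : Omega M) : IsSucc n.succ.1 n.1 := by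
  unfold succ
  exact (exists_isSucc n.1).choose_spec

theorem isZero_iff {n : Omega M} : IsZero n.1 ↔ n = 0 :=
  ⟨fun h => Subtype.ext (h.eq isZero_zero), fun h => h ▸ isZero_zero⟩

theorem isSucc_iff {m n : Omega M} : IsSucc m.1 n.1 ↔ m = n.succ :=
  ⟨fun h => Subtype.ext (h.eq (isSucc_succ n)), fun h => h ▸ isSucc_succ n⟩

theorem succ_inj {m n : Omega M} (h : m.succ = n.succ) : m = n :=
  Subtype.ext ((isSucc_succ m).inj (h ▸ isSucc_succ n))

theorem succ_ne_zero (n : Omega M) : n.succ ≠ 0 := fun h =>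
  isZero_zero n.1 (h ▸ (isSucc_succ n n.1).2 (Or.inr rfl))

@[fun_prop]
theorem dfn_succ : Dfn M (fun n : Omega M => n.succ) := by
  refine Dfn.of_graph ?_
  have : (fun p : Omega M × Omega M => p.1.succ = p.2) = fun p => IsSucc p.2.1 p.1.1 :=
    funext fun p => propext (eq_comm.trans isSucc_iff.symm)
  rw [this]
  fun_prop

/-- Definability is essential: only then do the numbers satisfying P form a set of the model, which
is inductive and so contains every natural number. -/
theorem induction' {P : Omega M → Prop} (hP : Dfn M P) (h0 : P 0)
    (hs : ∀ n, P n → P n.succ) (n : Omega M) : P n := by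
  obtain ⟨w, hw⟩ := exists_omega M
  obtain ⟨b, hb⟩ := separation (M := M) (P := fun x => ∃ n : Omega M, n.1 = x ∧ P n)
    (by fun_prop) w
  have : IsInductive b := by
    refine ⟨⟨_, isZero_zero, (hb _).2 ⟨(hw _).2 (0 : Omega M).2, 0, rfl, h0⟩⟩, ?_⟩
    intro x hx
    obtain ⟨-, m, rfl, hm⟩ := (hb x).1 hx
    exact ⟨_, isSucc_succ m, (hb _).2 ⟨(hw _).2 m.succ.2, m.succ, rfl, hs m hm⟩⟩
  obtain ⟨-, m, h1, hm⟩ := (hb _).1 (n.2 b this)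
  rwa [← Subtype.ext h1]

/-- A definable relation on `ω` is the graph of a set of pairs. -/
theorem exists_graph {φ : Omega M → Omega M → Prop}
    (hφ : Dfn M (fun x : Omega M × Omega M => φ x.1 x.2)) :
    ∃ f : M, (∀ p, p ∈ₘ f → ∃ a b, IsNat a ∧ IsNat b ∧ IsPair p a b) ∧
      (∀ a b : Omega M, App f a.1 b.1 ↔ φ a b) := by
  obtain ⟨w, hw⟩ := exists_omega M
  obtain ⟨f, h1, h2⟩ := SetModel.exists_graph (M := M)
    (φ := fun a b => ∃ m n : Omega M, m.1 = a ∧ n.1 = b ∧ φ m n) (by fun_prop) w w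
  refine ⟨f, fun p hp => ?_, fun a b => (h2 _ _).trans ⟨?_, fun h => ?_⟩⟩
  · obtain ⟨a, b, ha, hb, h⟩ := h1 p hp
    exact ⟨a, b, (hw a).1 ha, (hw b).1 hb, h⟩
  · rintro ⟨-, -, m, n, h1, h2, h3⟩
    obtain rfl := Subtype.ext h1
    obtain rfl := Subtype.ext h2
    exact h3
  · exact ⟨(hw _).2 a.2, (hw _).2 b.2, a, b, rfl, rfl, h⟩

theorem exists_partFun {φ : Omega M → Omega M → Prop}
    (hφ : Dfn M (fun x : Omega M × Omega M => φ x.1 x.2))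
    (h : ∀ a b b', φ a b → φ a b' → b = b') :
    ∃ f : M, IsPartFun f ∧ ∀ a b : Omega M, App f a.1 b.1 ↔ φ a b := by
  obtain ⟨f, h1, h2⟩ := exists_graph hφ
  refine ⟨f, ⟨h1, fun a b b' hb hb' => ?_⟩, h2⟩
  obtain ⟨a, b, rfl, rfl⟩ := app_nat h1 hb
  obtain ⟨_, b', -, rfl⟩ := app_nat h1 hb'
  rw [h2] at hb hb'
  rw [h a b b' hb hb']

/-- Definition of a function on `ω` by iteration. -/
theorem exists_iterate (a : Omega M) {S : Omega M → Omega M} (hS : Dfn M S) :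
    ∃ r : Omega M → Omega M, Dfn M r ∧ r 0 = a ∧ ∀ n, r n.succ = S (r n) := by
  -- T is the least relation containing (0, a) and closed under (k, l) ↦ (k + 1, S l). As the sets X
  -- range over M, T is definable.
  let T : Omega M → Omega M → Prop := fun n m => ∀ X : M, App X (0 : Omega M).1 a.1 →
    (∀ k l : Omega M, App X k.1 l.1 → App X k.succ.1 (S l).1) → App X n.1 m.1
  have hT : Dfn M (fun x : Omega M × Omega M => T x.1 x.2) := by
    simp only [T]
    fun_prop
  have T0 : T 0 a := fun X h _ => h
  have Ts : ∀ n m, T n m → T n.succ (S m) := fun n m h X h1 h2 => h2 n m (h X h1 h2)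
  have hu : ∀ n, ∃ m, T n m ∧ ∀ l, T n l → l = m := by
    refine induction' (by fun_prop) ⟨a, T0, fun l hl => ?_⟩ ?_
    -- Uniqueness by minimality: dropping the unwanted values from T leaves a closed relation, so T
    -- had none. The successor case uses the same device.
    · obtain ⟨X, -, hX⟩ := exists_graph (M := M) (φ := fun n m => T n m ∧ (n = 0 → m = a))
        (by fun_prop)
      refine ((hX _ _).1 (hl X ((hX _ _).2 ⟨T0, fun _ => rfl⟩) fun k l h => (hX _ _).2 ?_)).2 rfl
      exact ⟨Ts _ _ ((hX _ _).1 h).1, fun h => (succ_ne_zero _ h).elim⟩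
    · rintro n ⟨m, hm, hm'⟩
      refine ⟨S m, Ts _ _ hm, fun l hl => ?_⟩
      obtain ⟨X, -, hX⟩ := exists_graph (M := M)
        (φ := fun k l => T k l ∧ (k = n.succ → l = S m)) (by fun_prop)
      refine ((hX _ _).1 (hl X ((hX _ _).2 ⟨T0, fun h => (succ_ne_zero _ h.symm).elim⟩)
        fun k l h => (hX _ _).2 ?_)).2 rfl
      have h1 := ((hX _ _).1 h).1
      refine ⟨Ts _ _ h1, fun h => ?_⟩
      obtain rfl := succ_inj h
      rw [hm' l h1]
  choose r hr hr' using hu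
  refine ⟨r, Dfn.of_graph ?_, (hr' 0 a T0).symm, fun n => (hr' _ _ (Ts _ _ (hr n))).symm⟩
  have : (fun p : Omega M × Omega M => r p.1 = p.2) = fun p => T p.1 p.2 :=
    funext fun p => propext ⟨fun h => h ▸ hr p.1, fun h => (hr' _ _ h).symm⟩
  rw [this]
  exact hT

/-- The two recursion schemes defining addition and multiplication in the model. -/
theorem iterate_iff {a : Omega M} {S : Omega M → Omega M} {r : Omega M → Omega M}
    (hr : Dfn M r) (h0 : r 0 = a) (hs : ∀ n, r n.succ = S (r n)) {b c : Omega M} :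
    (∃ f : M, IsPartFun f ∧ App f (0 : Omega M).1 a.1 ∧
      (∀ n m : Omega M, App f n.1 m.1 → App f n.succ.1 (S m).1) ∧ App f b.1 c.1) ↔ r b = c := by
  constructor
  · rintro ⟨f, hf, hf0, hfs, hb⟩
    have : ∀ n, App f n.1 (r n).1 := by
      refine induction' (by fun_prop) (h0 ▸ hf0) fun n hn => ?_
      rw [hs]
      exact hfs _ _ hn
    exact Subtype.ext (hf.2 _ _ _ (this b) hb)
  · intro h
    obtain ⟨f, h1, h2⟩ := exists_partFun (M := M) (φ := fun a b => r a = b) (by fun_prop)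
      (by rintro a b b' rfl rfl; rfl)
    refine ⟨f, h1, (h2 _ _).2 h0, fun n m h => (h2 _ _).2 ?_, (h2 _ _).2 h⟩
    rw [hs, (h2 _ _).1 h]

theorem isAdd_iff' {a b c : Omega M} : IsAdd a.1 b.1 c.1 ↔
    ∃ f : M, IsPartFun f ∧ App f (0 : Omega M).1 a.1 ∧
      (∀ n m : Omega M, App f n.1 m.1 → App f n.succ.1 m.succ.1) ∧ App f b.1 c.1 := by
  refine exists_congr fun f => and_congr_right fun hf => and_congr ?_ (and_congr ?_ Iff.rfl)
  · exact ⟨fun h => h _ isZero_zero, fun h z hz => hz.eq isZero_zero ▸ h⟩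
  · refine ⟨fun h n m h' => h _ _ _ _ h' (isSucc_succ _) (isSucc_succ _), ?_⟩
    intro h n m n' m' h' h1 h2
    obtain ⟨n, m, rfl, rfl⟩ := app_nat hf.1 h'
    rw [h1.eq (isSucc_succ n), h2.eq (isSucc_succ m)]
    exact h _ _ h'

theorem exists_add (a b : Omega M) : ∃ c : Omega M, IsAdd a.1 b.1 c.1 := by
  obtain ⟨r, h1, h2, h3⟩ := exists_iterate a (S := succ) (by fun_prop)
  exact ⟨r b, isAdd_iff'.2 ((iterate_iff h1 h2 h3).2 rfl)⟩

/-- The function defined by `IsAdd`. -/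
@[irreducible] noncomputable def add (a b : Omega M) : Omega M := (exists_add a b).choose

noncomputable instance : Add (Omega M) := ⟨add⟩

theorem isAdd_add (a b : Omega M) : IsAdd a.1 b.1 (a + b).1 := by
  change IsAdd a.1 b.1 (add a b).1
  unfold add
  exact (exists_add a b).choose_spec

theorem isAdd_iff {a b c : Omega M} : IsAdd a.1 b.1 c.1 ↔ a + b = c := by
  obtain ⟨r, h1, h2, h3⟩ := exists_iterate a (S := succ) (by fun_prop)
  have h4 : ∀ {b c : Omega M}, IsAdd a.1 b.1 c.1 ↔ r b = c := by
    intro b c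
    exact isAdd_iff'.trans (iterate_iff h1 h2 h3)
  have h5 : r b = a + b := h4.1 (isAdd_add a b)
  rw [h4, h5]

@[fun_prop]
theorem dfn_add : Dfn M (fun p : Omega M × Omega M => p.1 + p.2) := by
  refine Dfn.of_graph ?_
  simp only [← isAdd_iff]
  fun_prop

protected theorem add_zero' (a : Omega M) : a + 0 = a := by
  obtain ⟨r, h1, h2, h3⟩ := exists_iterate a (S := succ) (by fun_prop)
  exact isAdd_iff.1 (isAdd_iff'.2 ((iterate_iff h1 h2 h3).2 h2))

protected theorem add_succ (a b : Omega M) : a + b.succ = (a + b).succ := by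
  obtain ⟨r, h1, h2, h3⟩ := exists_iterate a (S := succ) (by fun_prop)
  have h4 : ∀ {b c : Omega M}, a + b = c ↔ r b = c := by
    intro b c
    exact isAdd_iff.symm.trans (isAdd_iff'.trans (iterate_iff h1 h2 h3))
  rw [h4, h3, ← h4.1 rfl]

theorem isMul_iff' {a b c : Omega M} : IsMul a.1 b.1 c.1 ↔
    ∃ f : M, IsPartFun f ∧ App f (0 : Omega M).1 (0 : Omega M).1 ∧
      (∀ n m : Omega M, App f n.1 m.1 → App f n.succ.1 (m + a).1) ∧ App f b.1 c.1 := by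
  refine exists_congr fun f => and_congr_right fun hf => and_congr ?_ (and_congr ?_ Iff.rfl)
  · exact ⟨fun h => h _ isZero_zero, fun h z hz => hz.eq isZero_zero ▸ h⟩
  · refine ⟨fun h n m h' => h _ _ _ _ h' (isSucc_succ _) (isAdd_add _ _), ?_⟩
    intro h n m n' m' h' h1 h2
    obtain ⟨n, m, rfl, rfl⟩ := app_nat hf.1 h'
    have : ∃ c : Omega M, c.1 = m' := by
      obtain ⟨g, hg, -, -, hg'⟩ := h2
      obtain ⟨_, c, -, hc⟩ := app_nat hg.1 hg'
      exact ⟨c, hc⟩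
    obtain ⟨c, rfl⟩ := this
    rw [h1.eq (isSucc_succ n), ← isAdd_iff.1 h2]
    exact h _ _ h'

theorem exists_mul (a b : Omega M) : ∃ c : Omega M, IsMul a.1 b.1 c.1 := by
  obtain ⟨r, h1, h2, h3⟩ := exists_iterate 0 (S := fun m => m + a) (by fun_prop)
  exact ⟨r b, isMul_iff'.2 ((iterate_iff h1 h2 h3).2 rfl)⟩

/-- The function defined by `IsMul`. -/
@[irreducible] noncomputable def mul (a b : Omega M) : Omega M := (exists_mul a b).choose

noncomputable instance : Mul (Omega M) := ⟨mul⟩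

theorem isMul_mul (a b : Omega M) : IsMul a.1 b.1 (a * b).1 := by
  change IsMul a.1 b.1 (mul a b).1
  unfold mul
  exact (exists_mul a b).choose_spec

theorem isMul_iff {a b c : Omega M} : IsMul a.1 b.1 c.1 ↔ a * b = c := by
  obtain ⟨r, h1, h2, h3⟩ := exists_iterate 0 (S := fun m => m + a) (by fun_prop)
  have h4 : ∀ {b c : Omega M}, IsMul a.1 b.1 c.1 ↔ r b = c := by
    intro b c
    exact isMul_iff'.trans (iterate_iff h1 h2 h3)
  have h5 : r b = a * b := h4.1 (isMul_mul a b)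
  rw [h4, h5]

@[fun_prop]
theorem dfn_mul : Dfn M (fun p : Omega M × Omega M => p.1 * p.2) := by
  refine Dfn.of_graph ?_
  simp only [← isMul_iff]
  fun_prop

protected theorem mul_zero' (a : Omega M) : a * 0 = 0 := by
  obtain ⟨r, h1, h2, h3⟩ := exists_iterate 0 (S := fun m => m + a) (by fun_prop)
  exact isMul_iff.1 (isMul_iff'.2 ((iterate_iff h1 h2 h3).2 h2))

protected theorem mul_succ (a b : Omega M) : a * b.succ = a * b + a := by
  obtain ⟨r, h1, h2, h3⟩ := exists_iterate 0 (S := fun m => m + a) (by fun_prop)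
  have h4 : ∀ {b c : Omega M}, a * b = c ↔ r b = c := by
    intro b c
    exact isMul_iff.symm.trans (isMul_iff'.trans (iterate_iff h1 h2 h3))
  rw [h4, h3, ← h4.1 rfl]

end Omega

end ZF

/-! ### Arithmetic of `ω` -/

section Arithmetic

variable {M : Type*} [setLang.Structure M] [hM : ModelOfZF M]

namespace Omega

protected theorem zero_add' (a : Omega M) : 0 + a = a := by
  refine induction' (P := fun a : Omega M => (0 : Omega M) + a = a) (by fun_prop) (Omega.add_zero' 0) ?_ a
  intro n hn
  rw [Omega.add_succ, hn]

protected theorem succ_add (a b : Omega M) : a.succ + b = (a + b).succ := by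
  refine induction' (P := fun b => a.succ + b = (a + b).succ) (by fun_prop) ?_ ?_ b
  · rw [Omega.add_zero', Omega.add_zero']
  · intro n hn
    rw [Omega.add_succ, hn, Omega.add_succ]

protected theorem add_comm' (a b : Omega M) : a + b = b + a := by
  refine induction' (P := fun b => a + b = b + a) (by fun_prop) ?_ ?_ b
  · rw [Omega.add_zero', Omega.zero_add']
  · intro n hn
    rw [Omega.add_succ, hn, Omega.succ_add]

protected theorem add_assoc' (a b c : Omega M) : a + b + c = a + (b + c) := by
  refine induction' (P := fun c => a + b + c = a + (b + c)) (by fun_prop) ?_ ?_ c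
  · rw [Omega.add_zero', Omega.add_zero']
  · intro n hn
    rw [Omega.add_succ, hn, Omega.add_succ, Omega.add_succ]

protected theorem zero_mul' (a : Omega M) : 0 * a = 0 := by
  refine induction' (P := fun a : Omega M => (0 : Omega M) * a = 0) (by fun_prop) (Omega.mul_zero' 0) ?_ a
  intro n hn
  rw [Omega.mul_succ, hn, Omega.add_zero']

protected theorem succ_mul (a b : Omega M) : a.succ * b = a * b + b := by
  refine induction' (P := fun b => a.succ * b = a * b + b) (by fun_prop) ?_ ?_ b
  · rw [Omega.mul_zero', Omega.mul_zero', Omega.add_zero']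
  · intro n hn
    rw [Omega.mul_succ, hn, Omega.mul_succ, Omega.add_succ, Omega.add_succ, Omega.add_assoc',
      Omega.add_assoc', Omega.add_comm' n a]

protected theorem mul_comm' (a b : Omega M) : a * b = b * a := by
  refine induction' (P := fun b => a * b = b * a) (by fun_prop) ?_ ?_ b
  · rw [Omega.mul_zero', Omega.zero_mul']
  · intro n hn
    rw [Omega.mul_succ, hn, Omega.succ_mul]

protected theorem mul_add' (a b c : Omega M) : a * (b + c) = a * b + a * c := by
  refine induction' (P := fun c => a * (b + c) = a * b + a * c) (by fun_prop) ?_ ?_ c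
  · rw [Omega.mul_zero', Omega.add_zero', Omega.add_zero']
  · intro n hn
    rw [Omega.add_succ, Omega.mul_succ, hn, Omega.mul_succ, Omega.add_assoc']

protected theorem mul_assoc' (a b c : Omega M) : a * b * c = a * (b * c) := by
  refine induction' (P := fun c => a * b * c = a * (b * c)) (by fun_prop) ?_ ?_ c
  · rw [Omega.mul_zero', Omega.mul_zero', Omega.mul_zero']
  · intro n hn
    rw [Omega.mul_succ, hn, Omega.mul_succ, Omega.mul_add']

noncomputable instance : CommSemiring (Omega M) where
  add_assoc := Omega.add_assoc'
  zero_add := Omega.zero_add'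
  add_zero := Omega.add_zero'
  nsmul := nsmulRec
  add_comm := Omega.add_comm'
  left_distrib := Omega.mul_add'
  right_distrib a b c := by
    rw [Omega.mul_comm', Omega.mul_add', Omega.mul_comm' c, Omega.mul_comm' c]
  zero_mul := Omega.zero_mul'
  mul_zero := Omega.mul_zero'
  mul_assoc := Omega.mul_assoc'
  one := succ 0
  one_mul a := by
    change succ 0 * a = a
    rw [Omega.succ_mul, Omega.zero_mul', Omega.zero_add']
  mul_one a := by
    change a * succ 0 = a
    rw [Omega.mul_succ, Omega.mul_zero', Omega.zero_add']
  mul_comm := Omega.mul_comm'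

theorem succ_eq (n : Omega M) : n.succ = n + 1 := by
  change n.succ = n + succ 0
  rw [Omega.add_succ, add_zero]

theorem isSucc_add_one (n : Omega M) : IsSucc (n + 1).1 n.1 := succ_eq n ▸ isSucc_succ n

theorem add_one_ne_zero (n : Omega M) : n + 1 ≠ 0 := succ_eq n ▸ succ_ne_zero n

theorem induction {P : Omega M → Prop} (hP : Dfn M P) (h0 : P 0)
    (hs : ∀ n, P n → P (n + 1)) (n : Omega M) : P n :=
  induction' hP h0 (fun n hn => (succ_eq n).symm ▸ hs n hn) n

theorem eq_zero_or_eq_add_one (n : Omega M) : n = 0 ∨ ∃ m, n = m + 1 := by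
  refine induction (P := fun n : Omega M => n = (0 : Omega M) ∨ ∃ m, n = m + 1) (by fun_prop) (Or.inl rfl) ?_ n
  exact fun m _ => Or.inr ⟨m, rfl⟩

protected theorem add_right_cancel' {a b : Omega M} (c : Omega M) : a + c = b + c → a = b := by
  refine induction (P := fun c => a + c = b + c → a = b) (by fun_prop) (by simp) ?_ c
  intro n hn h
  refine hn (succ_inj ?_)
  rwa [succ_eq, succ_eq, add_assoc, add_assoc]

protected theorem eq_zero_of_add {a b : Omega M} (h : a + b = 0) : a = 0 := by
  rcases eq_zero_or_eq_add_one a with rfl | ⟨m, rfl⟩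
  · rfl
  · rw [add_right_comm] at h
    exact (add_one_ne_zero _ h).elim

noncomputable instance : LinearOrder (Omega M) where
  le a b := ∃ c, a + c = b
  le_refl a := ⟨0, add_zero a⟩
  le_trans := by
    rintro a _ _ ⟨c, rfl⟩ ⟨d, rfl⟩
    exact ⟨c + d, (add_assoc _ _ _).symm⟩
  le_antisymm := by
    rintro a _ ⟨c, rfl⟩ ⟨d, h⟩
    have : c + d = 0 := by
      refine Omega.add_right_cancel' a ?_
      rw [zero_add, add_comm, ← add_assoc, h]
    rw [Omega.eq_zero_of_add this, add_zero]
  le_total a b := by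
    refine induction (P := fun b => (∃ c, a + c = b) ∨ ∃ c, b + c = a) (by fun_prop)
      (Or.inr ⟨a, zero_add a⟩) ?_ b
    rintro n (⟨c, rfl⟩ | ⟨c, rfl⟩)
    · exact Or.inl ⟨c + 1, (add_assoc _ _ _).symm⟩
    · rcases eq_zero_or_eq_add_one c with rfl | ⟨m, rfl⟩
      · exact Or.inl ⟨1, by rw [add_zero]⟩
      · exact Or.inr ⟨m, by rw [add_right_comm, add_assoc]⟩
  toDecidableLE := Classical.decRel _

protected theorem le_def {a b : Omega M} : a ≤ b ↔ ∃ c, a + c = b := Iff.rfl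

instance : IsOrderedCancelAddMonoid (Omega M) where
  add_le_add_left := by
    rintro a _ ⟨c, rfl⟩ d
    exact ⟨c, add_right_comm _ _ _⟩
  le_of_add_le_add_left := by
    rintro a b c ⟨d, h⟩
    refine ⟨d, Omega.add_right_cancel' a ?_⟩
    rw [add_comm, ← add_assoc, h, add_comm]

instance : CanonicallyOrderedAdd (Omega M) where
  exists_add_of_le := by
    rintro a _ ⟨c, rfl⟩
    exact ⟨c, rfl⟩
  le_add_self a b := ⟨b, add_comm _ _⟩
  le_self_add a b := ⟨b, rfl⟩

instance : Nontrivial (Omega M) := ⟨0, 0 + 1, (add_one_ne_zero 0).symm⟩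

instance : IsOrderedRing (Omega M) where
  zero_le_one := zero_le
  mul_le_mul_of_nonneg_left := by
    rintro a - b _ ⟨c, rfl⟩
    exact ⟨a * c, (mul_add _ _ _).symm⟩
  mul_le_mul_of_nonneg_right := by
    rintro a - b _ ⟨c, rfl⟩
    exact ⟨c * a, (add_mul _ _ _).symm⟩

theorem lt_add_one_iff {a b : Omega M} : a < b + 1 ↔ a ≤ b := by
  constructor
  · intro h
    obtain ⟨c, hc⟩ := Omega.le_def.1 h.le
    rcases eq_zero_or_eq_add_one c with rfl | ⟨m, rfl⟩
    · rw [add_zero] at hc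
      exact (h.ne hc).elim
    · exact ⟨m, Omega.add_right_cancel' 1 (by rw [add_assoc, hc])⟩
  · intro h
    refine lt_of_le_of_ne (h.trans ⟨1, rfl⟩) ?_
    rintro rfl
    obtain ⟨c, hc⟩ := Omega.le_def.1 h
    refine add_one_ne_zero c (Omega.add_right_cancel' b ?_)
    rw [zero_add, add_comm, add_comm c, ← add_assoc, hc]

theorem add_one_le_iff {a b : Omega M} : a + 1 ≤ b ↔ a < b := by
  rw [← lt_add_one_iff, add_lt_add_iff_right]

instance : CharZero (Omega M) where
  cast_injective := (strictMono_nat_of_lt_succ fun n => by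
    rw [Nat.cast_succ]
    exact lt_add_one_iff.2 le_rfl).injective

/-- Transitivity of ω, needed because the clause for minimization quantifies over the elements of a
number. -/
theorem mem_of_mem_isNat (n : Omega M) {x : M} (h : x ∈ₘ n.1) : IsNat x := by
  refine induction (P := fun n => ∀ x, x ∈ₘ n.1 → IsNat x) (by fun_prop)
    (fun x hx => (isZero_zero x hx).elim) ?_ n x h
  intro m hm y hy
  rcases (isSucc_add_one m y).1 hy with h | rfl
  · exact hm y h
  · exact m.2

theorem mem_iff_lt {a b : Omega M} : a.1 ∈ₘ b.1 ↔ a < b := by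
  simp only [← add_one_le_iff, Omega.le_def]
  refine induction (P := fun b => a.1 ∈ₘ b.1 ↔ ∃ c, a + 1 + c = b) (by fun_prop) ?_ ?_ b
  · refine iff_of_false (isZero_zero _) ?_
    rintro ⟨c, hc⟩
    exact add_one_ne_zero _ (Omega.eq_zero_of_add hc)
  · intro n hn
    rw [isSucc_add_one n, hn]
    simp only [← Omega.le_def]
    rw [add_le_add_iff_right, add_one_le_iff]
    exact Iff.trans (or_congr Iff.rfl ⟨fun h => Subtype.ext h, fun h => h ▸ rfl⟩)
      le_iff_lt_or_eq.symm

@[fun_prop]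
theorem dfn_lt : Dfn M (fun p : Omega M × Omega M => p.1 < p.2) := by
  simp only [← mem_iff_lt]
  fun_prop

@[fun_prop]
theorem dfn_le : Dfn M (fun p : Omega M × Omega M => p.1 ≤ p.2) := by
  simp only [Omega.le_def]
  fun_prop

theorem strong_induction {P : Omega M → Prop} (hP : Dfn M P)
    (h : ∀ n, (∀ m, m < n → P m) → P n) (n : Omega M) : P n := by
  have : ∀ n m, m < n → P m := by
    refine induction (by fun_prop) (fun m hm => (not_lt_zero hm).elim) ?_
    exact fun n hn m hm => h m fun k hk => hn k (hk.trans_le (lt_add_one_iff.1 hm))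
  exact h n (this n)

theorem exists_least {P : Omega M → Prop} (hP : Dfn M P) (h : ∃ n, P n) :
    ∃ n, P n ∧ ∀ m, m < n → ¬ P m := by
  by_contra! h'
  obtain ⟨n, hn⟩ := h
  refine strong_induction (P := fun n => ¬ P n) (by fun_prop) (fun n hn h => ?_) n hn
  obtain ⟨m, h1, h2⟩ := h' n h
  exact hn m h1 h2

/-- Bounds for finitely many upward closed properties combine. -/
theorem exists_bound {P : Omega M → Omega M → Prop}
    (hP : Dfn M (fun x : Omega M × Omega M => P x.1 x.2))
    (hmono : ∀ i s t, s ≤ t → P i s → P i t) (n : Omega M) :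
    (∀ i, i < n → ∃ s, P i s) → ∃ s, ∀ i, i < n → P i s := by
  refine induction (P := fun n => (∀ i, i < n → ∃ s, P i s) → ∃ s, ∀ i, i < n → P i s)
    (by fun_prop) (fun _ => ⟨0, fun i hi => (not_lt_zero hi).elim⟩) ?_ n
  intro n hn h
  obtain ⟨s, hs⟩ := hn fun i hi => h i (hi.trans (lt_add_one n))
  obtain ⟨t, ht⟩ := h n (lt_add_one n)
  refine ⟨max s t, fun i hi => ?_⟩
  rcases (lt_add_one_iff.1 hi).lt_or_eq with h1 | rfl
  · exact hmono _ _ _ (le_max_left _ _) (hs i h1)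
  · exact hmono _ _ _ (le_max_right _ _) ht

/-! ### The pairing function -/

theorem le_mul_self (a : Omega M) : a ≤ a * a := by
  rcases eq_zero_or_eq_add_one a with rfl | ⟨m, rfl⟩
  · exact zero_le
  · exact ⟨m * (m + 1), by ring⟩

/-- The pairing function used by `IsNatPair`. -/
@[irreducible]
noncomputable def pair (a b : Omega M) : Omega M :=
  if a < b then b * b + a else a * a + a + b

theorem isNatPair_iff {a b c : Omega M} : IsNatPair a.1 b.1 c.1 ↔ pair a b = c := by
  have hadd : ∀ {s : M} {x y : Omega M}, IsAdd s x.1 y.1 → IsNat s := by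
    rintro s x y ⟨f, hf, h0, -⟩
    obtain ⟨_, m, -, rfl⟩ := app_nat hf.1 (h0 _ (isZero_zero (M := M)))
    exact m.2
  unfold IsNatPair pair
  simp only [mem_iff_lt, a.2, b.2, c.2, true_and]
  split_ifs with h
  · simp only [h, true_and, not_true_eq_false, false_and, or_false]
    constructor
    · rintro ⟨s, hs, hs'⟩
      obtain ⟨s, rfl⟩ : ∃ t : Omega M, t.1 = s := ⟨⟨s, hadd hs'⟩, rfl⟩
      rw [isMul_iff.1 hs, isAdd_iff.1 hs']
    · rintro rfl
      exact ⟨_, isMul_mul b b, isAdd_add _ _⟩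
  · simp only [h, true_and, not_false_eq_true, false_and, false_or]
    constructor
    · rintro ⟨s, t, hs, hs', ht⟩
      obtain ⟨t, rfl⟩ : ∃ u : Omega M, u.1 = t := ⟨⟨t, hadd ht⟩, rfl⟩
      obtain ⟨s, rfl⟩ : ∃ t : Omega M, t.1 = s := ⟨⟨s, hadd hs'⟩, rfl⟩
      rw [isMul_iff.1 hs, isAdd_iff.1 hs', isAdd_iff.1 ht]
    · rintro rfl
      exact ⟨_, _, isMul_mul a a, isAdd_add _ _, isAdd_add _ _⟩

@[fun_prop]
theorem dfn_pair : Dfn M (fun p : Omega M × Omega M => pair p.1 p.2) := by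
  refine Dfn.of_graph ?_
  simp only [← isNatPair_iff]
  fun_prop

/-- The pairs with a given maximum k take values in the interval [k², (k + 1)²). These intervals are
disjoint, so a code determines the maximum of its components. -/
theorem pair_bounds (a b : Omega M) :
    max a b * max a b ≤ pair a b ∧ pair a b < (max a b + 1) * (max a b + 1) := by
  unfold pair
  split_ifs with h
  · rw [max_eq_right h.le]
    refine ⟨le_self_add, lt_of_lt_of_le (add_lt_add_right h _) ⟨b + 1, by ring⟩⟩
  · have h := not_lt.1 h
    rw [max_eq_left h]
    refine ⟨le_self_add.trans le_self_add, lt_of_le_of_lt (add_le_add_right h _) ?_⟩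
    rw [← add_one_le_iff]
    exact ⟨0, by ring⟩

theorem pair_inj {a b c d : Omega M} (h : pair a b = pair c d) : a = c ∧ b = d := by
  have key : ∀ x y z w : Omega M, pair x y = pair z w → max x y ≤ max z w := by
    intro x y z w h
    by_contra h'
    have h1 := add_one_le_iff.2 (not_le.1 h')
    have h2 := (mul_le_mul' h1 h1).trans (pair_bounds x y).1
    rw [h] at h2
    exact h2.not_gt (pair_bounds z w).2
  have hm := le_antisymm (key _ _ _ _ h) (key _ _ _ _ h.symm)
  unfold pair at h
  split_ifs at h with h1 h2 h2
  · rw [max_eq_right h1.le, max_eq_right h2.le] at hm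
    subst hm
    exact ⟨add_left_cancel h, rfl⟩
  · rw [max_eq_right h1.le, max_eq_left (not_lt.1 h2)] at hm
    subst hm
    rw [add_assoc] at h
    have := add_left_cancel h
    rw [this] at h1
    exact (le_self_add.not_gt h1).elim
  · rw [max_eq_left (not_lt.1 h1), max_eq_right h2.le] at hm
    subst hm
    rw [add_assoc] at h
    have := add_left_cancel h
    rw [← this] at h2
    exact (le_self_add.not_gt h2).elim
  · rw [max_eq_left (not_lt.1 h1), max_eq_left (not_lt.1 h2)] at hm
    subst hm
    exact ⟨rfl, add_left_cancel h⟩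

theorem exists_pair_eq (c : Omega M) : ∃ a b, pair a b = c := by
  refine induction (P := fun c => ∃ a b, pair a b = c) (by fun_prop) ⟨0, 0, ?_⟩ ?_ c
  · simp [pair]
  -- The enumeration runs through the pairs with maximum k in the order (0, k), …, (k - 1, k), (k,
  -- 0), …, (k, k) and then starts at (0, k + 1). The four cases give the successor in this order.
  · rintro _ ⟨a, b, rfl⟩
    rcases lt_or_ge a b with h | h
    · rcases (add_one_le_iff.2 h).lt_or_eq with h1 | rfl
      · refine ⟨a + 1, b, ?_⟩
        simp only [pair, h, h1, if_true]
        ring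
      · refine ⟨a + 1, 0, ?_⟩
        simp only [pair, lt_add_one, if_true, not_lt_zero, if_false]
        ring
    · rcases h.lt_or_eq with h1 | rfl
      · refine ⟨a, b + 1, ?_⟩
        simp only [pair, h.not_gt, (add_one_le_iff.2 h1).not_gt, if_false]
        ring
      · refine ⟨0, b + 1, ?_⟩
        have h2 : (0 : Omega M) < b + 1 := lt_add_one_iff.2 zero_le
        simp only [pair, h2, if_true, lt_irrefl, if_false]
        ring

/-- The first component of a pair. -/
@[irreducible]
noncomputable def left (c : Omega M) : Omega M := (exists_pair_eq c).choose

/-- The second component of a pair. -/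
@[irreducible]
noncomputable def right (c : Omega M) : Omega M := (exists_pair_eq c).choose_spec.choose

@[simp] theorem pair_left_right (c : Omega M) : pair (left c) (right c) = c := by
  unfold left right
  exact (exists_pair_eq c).choose_spec.choose_spec

@[simp] theorem left_pair (a b : Omega M) : left (pair a b) = a :=
  (pair_inj (pair_left_right (pair a b))).1

@[simp] theorem right_pair (a b : Omega M) : right (pair a b) = b :=
  (pair_inj (pair_left_right (pair a b))).2

@[fun_prop]
theorem dfn_left : Dfn M (fun c : Omega M => left c) := by
  refine Dfn.of_graph ?_
  have : (fun p : Omega M × Omega M => left p.1 = p.2) = fun p => ∃ b, pair p.2 b = p.1 :=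
    funext fun p => propext ⟨fun h => ⟨right p.1, by rw [← h, pair_left_right]⟩,
      fun ⟨b, hb⟩ => by rw [← hb, left_pair]⟩
  rw [this]
  fun_prop

@[fun_prop]
theorem dfn_right : Dfn M (fun c : Omega M => right c) := by
  refine Dfn.of_graph ?_
  have : (fun p : Omega M × Omega M => right p.1 = p.2) = fun p => ∃ a, pair a p.2 = p.1 :=
    funext fun p => propext ⟨fun h => ⟨left p.1, by rw [← h, pair_left_right]⟩,
      fun ⟨b, hb⟩ => by rw [← hb, right_pair]⟩
  rw [this]
  fun_prop

theorem left_le_pair (a b : Omega M) : a ≤ pair a b :=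
  (le_max_left a b).trans ((le_mul_self _).trans (pair_bounds a b).1)

theorem right_le_pair (a b : Omega M) : b ≤ pair a b :=
  (le_max_right a b).trans ((le_mul_self _).trans (pair_bounds a b).1)

/-- Strictness makes a code with nonzero tag larger than the codes of its parts, so recursion on
codes is well founded. It fails for tag 0, which therefore never refers to its parts. -/
theorem right_lt_pair {a b : Omega M} (h : 0 < a) : b < pair a b := by
  unfold pair
  split_ifs
  · exact lt_of_le_of_lt (le_mul_self b) (lt_add_of_pos_right _ h)
  · exact lt_add_of_pos_left _ (lt_of_lt_of_le h le_add_self)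

end Omega

end Arithmetic

/-! ### Reals -/

section Reals

variable {M : Type*} [setLang.Structure M] [hM : ModelOfZF M]

@[fun_prop] theorem dfn_isReal : Dfn M (fun x : M => IsReal x) := by
  unfold IsReal; fun_prop

variable (M) in
/-- The reals of the model. -/
def PowOmega : Type _ := {x : M // IsReal x}

noncomputable instance : DefType M (PowOmega M) := DefType.subtype (p := IsReal) dfn_isReal

@[fun_prop]
theorem Dfn.powOmegaVal : Dfn M (fun x : PowOmega M => x.1) := Dfn.of_reindex _root_.id fun _ => rfl

instance : Membership (Omega M) (PowOmega M) := ⟨fun x n => n.1 ∈ₘ x.1⟩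

@[fun_prop]
theorem dfn_mem_powOmega {Γ : Type*} [DefType M Γ] {f : Γ → Omega M} {g : Γ → PowOmega M}
    (hf : Dfn M f) (hg : Dfn M g) : Dfn M (fun x => f x ∈ g x) :=
  Dfn.mem.comp ((Dfn.omegaVal.comp hf).prodMk (Dfn.powOmegaVal.comp hg))

namespace PowOmega

open Omega

@[ext]
theorem ext {x y : PowOmega M} (h : ∀ n, n ∈ x ↔ n ∈ y) : x = y := by
  refine Subtype.ext (set_ext fun n => ⟨fun hn => ?_, fun hn => ?_⟩)
  · exact (h ⟨n, x.2 n hn⟩).1 hn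
  · exact (h ⟨n, y.2 n hn⟩).2 hn

theorem comprehension {P : Omega M → Prop} (hP : Dfn M P) :
    ∃ x : PowOmega M, ∀ n, n ∈ x ↔ P n := by
  obtain ⟨w, hw⟩ := exists_omega M
  obtain ⟨b, hb⟩ := separation (M := M) (P := fun x => ∃ n : Omega M, n.1 = x ∧ P n)
    (by fun_prop) w
  refine ⟨⟨b, fun n hn => (hw n).1 ((hb n).1 hn).1⟩, fun n => (hb n.1).trans ⟨?_, fun h => ?_⟩⟩
  · rintro ⟨-, m, h1, hm⟩
    rwa [← Subtype.ext h1]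
  · exact ⟨(hw _).2 n.2, n, rfl, h⟩

variable (M) in
theorem exists_powOmega : ∃ p : M, ∀ x, x ∈ₘ p ↔ IsReal x := by
  obtain ⟨w, hw⟩ := exists_omega M
  obtain ⟨p, hp⟩ := hM.out.powerset w
  exact ⟨p, fun x => (hp x).trans (forall₂_congr fun y _ => hw y)⟩

open Classical in
/-- The real `{n | P n}`, for a definable predicate `P`. -/
@[irreducible]
noncomputable def mk (P : Omega M → Prop) : PowOmega M :=
  if h : ∃ x : PowOmega M, ∀ n, n ∈ x ↔ P n then h.choose
  else (comprehension (P := fun _ : Omega M => False) (by fun_prop)).choose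

theorem mem_mk {P : Omega M → Prop} (hP : Dfn M P) {n : Omega M} : n ∈ mk P ↔ P n := by
  unfold mk
  rw [dif_pos (comprehension hP)]
  exact (comprehension hP).choose_spec n

@[fun_prop]
theorem dfn_mk {Γ : Type*} [DefType M Γ] {P : Γ → Omega M → Prop}
    (hP : Dfn M (fun x : Γ × Omega M => P x.1 x.2)) : Dfn M (fun γ => mk (fun n => P γ n)) := by
  refine Dfn.of_graph ?_
  have : (fun p : Γ × PowOmega M => mk (fun n => P p.1 n) = p.2) =
      fun p => ∀ n, P p.1 n ↔ n ∈ p.2 := by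
    funext p
    have h : Dfn M (fun n => P p.1 n) := by fun_prop
    refine propext ⟨fun e n => ?_, fun e => ?_⟩
    · rw [← e, mem_mk h]
    · ext n
      rw [mem_mk h, e]
  rw [this]
  fun_prop

/-- The `c`-th column of a real. -/
noncomputable def col (x : PowOmega M) (c : Omega M) : PowOmega M := mk fun n => pair c n ∈ x

@[simp]
theorem mem_col {x : PowOmega M} {c n : Omega M} : n ∈ col x c ↔ pair c n ∈ x :=
  mem_mk (by fun_prop)

@[fun_prop]
theorem dfn_col : Dfn M (fun p : PowOmega M × Omega M => col p.1 p.2) := by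
  unfold col
  fun_prop

/-- The columns of a real with index below `c`. -/
noncomputable def restrict (x : PowOmega M) (c : Omega M) : PowOmega M :=
  mk fun p => p ∈ x ∧ left p < c

theorem mem_restrict {x : PowOmega M} {c n : Omega M} :
    n ∈ restrict x c ↔ n ∈ x ∧ left n < c :=
  mem_mk (by fun_prop)

@[fun_prop]
theorem dfn_restrict : Dfn M (fun p : PowOmega M × Omega M => restrict p.1 p.2) := by
  unfold restrict
  fun_prop

theorem restrict_congr {x y : PowOmega M} {c : Omega M}
    (h : ∀ d, d < c → col x d = col y d) : restrict x c = restrict y c := by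
  ext n
  simp only [mem_restrict, and_congr_left_iff]
  intro hn
  have := h _ hn
  rw [← pair_left_right n, ← mem_col, ← mem_col, this]

/-! ### Course-of-values recursion producing sequences of reals -/

section Recursion

variable {K : Omega M → PowOmega M → PowOmega M}

theorem recursion_unique {x y : PowOmega M} {c : Omega M} (hx : ∀ d, d < c → col x d = K d (restrict x d))
    (hy : ∀ d, d < c → col y d = K d (restrict y d)) : ∀ d, d < c → col x d = col y d := by
  refine strong_induction (by fun_prop) fun d ih hd => ?_
  rw [hx d hd, hy d hd, restrict_congr fun e he => ih e he (he.trans hd)]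

theorem exists_recursion (hK : Dfn M (fun x : Omega M × PowOmega M => K x.1 x.2)) :
    ∃ x : PowOmega M, ∀ c, col x c = K c (restrict x c) := by
  -- Solutions on initial segments exist by induction inside M. They agree where both are defined,
  -- so they can be glued without choosing one for each length.
  have h : ∀ c, ∃ x : PowOmega M, ∀ d, d < c → col x d = K d (restrict x d) := by
    refine induction (by fun_prop) ⟨mk fun _ => False, fun d hd => (not_lt_zero hd).elim⟩ ?_
    rintro c ⟨x, hx⟩
    let y : PowOmega M := mk fun p =>
      (left p < c ∧ p ∈ x) ∨ (left p = c ∧ right p ∈ K c (restrict x c))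
    have hy : ∀ p, p ∈ y ↔
        (left p < c ∧ p ∈ x) ∨ (left p = c ∧ right p ∈ K c (restrict x c)) :=
      fun p => mem_mk (by fun_prop)
    have h1 : ∀ d, d < c → col x d = col y d := by
      intro d hd
      ext n
      simp [hy, hd, hd.ne]
    refine ⟨y, fun d hd => ?_⟩
    rcases (lt_add_one_iff.1 hd).lt_or_eq with hd | rfl
    · rw [← h1 d hd, hx d hd, restrict_congr fun e he => h1 e (he.trans hd)]
    · rw [← restrict_congr h1]
      ext n
      simp [hy]
  let x : PowOmega M := mk fun p => ∃ y : PowOmega M,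
    (∀ d, d < left p + 1 → col y d = K d (restrict y d)) ∧ p ∈ y
  have hx : ∀ p, p ∈ x ↔ ∃ y : PowOmega M,
    (∀ d, d < left p + 1 → col y d = K d (restrict y d)) ∧ p ∈ y := fun p => mem_mk (by fun_prop)
  have key : ∀ (c : Omega M) (y : PowOmega M),
      (∀ d, d < c + 1 → col y d = K d (restrict y d)) → ∀ d, d < c + 1 → col x d = col y d := by
    intro c y hy d hd
    ext n
    rw [mem_col, mem_col, hx, left_pair]
    constructor
    · rintro ⟨z, hz, h1⟩
      have h2 := recursion_unique hz
        (fun e he => hy e (he.trans_le (add_one_le_iff.2 hd))) d (lt_add_one d)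
      rw [← mem_col, ← h2]
      exact mem_col.2 h1
    · intro h1
      exact ⟨y, fun e he => hy e (he.trans_le (add_one_le_iff.2 hd)), h1⟩
  refine ⟨x, fun c => ?_⟩
  obtain ⟨y, hy⟩ := h (c + 1)
  rw [key c y hy c (lt_add_one c), hy c (lt_add_one c),
    restrict_congr fun d hd => key c y hy d (hd.trans (lt_add_one c))]

open Classical in
/-- The sequence of reals given by course-of-values recursion along `K`. -/
@[irreducible]
noncomputable def recSeq (K : Omega M → PowOmega M → PowOmega M) : PowOmega M :=
  if h : ∃ x : PowOmega M, ∀ c, col x c = K c (restrict x c) then h.choose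
  else mk fun _ => False

theorem col_recSeq (hK : Dfn M (fun x : Omega M × PowOmega M => K x.1 x.2)) (c : Omega M) :
    col (recSeq K) c = K c (restrict (recSeq K) c) := by
  unfold recSeq
  rw [dif_pos (exists_recursion hK)]
  exact (exists_recursion hK).choose_spec c

/-- The recursion has exactly one solution, so its equations define the chosen one. -/
theorem dfn_recSeq {Γ : Type*} [DefType M Γ] {K : Γ → Omega M → PowOmega M → PowOmega M}
    (hK : Dfn M (fun x : Γ × Omega M × PowOmega M => K x.1 x.2.1 x.2.2)) :
    Dfn M (fun γ => recSeq (K γ)) := by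
  refine Dfn.of_graph ?_
  have : (fun p : Γ × PowOmega M => recSeq (K p.1) = p.2) =
      fun p => ∀ c, col p.2 c = K p.1 c (restrict p.2 c) := by
    funext p
    have h : Dfn M (fun x : Omega M × PowOmega M => K p.1 x.1 x.2) := by fun_prop
    refine propext ⟨fun e c => ?_, fun e => ?_⟩
    · rw [← e, col_recSeq h]
    · ext n
      have h1 := recursion_unique (fun d _ => col_recSeq h d) (fun d _ => e d) (left n)
        (lt_add_one _)
      rw [← pair_left_right n, ← mem_col, ← mem_col, h1]
  rw [this]
  fun_prop

end Recursion

/-! ### Reals as functions -/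

/-- Taking the least value, with default 0, makes every real code a total function on ω, so
quantifying over functions is quantifying over reals. -/
theorem exists_value (x : PowOmega M) (j : Omega M) : ∃ v,
    (pair j v ∈ x ∧ ∀ u, u < v → ¬ pair j u ∈ x) ∨ ((∀ u, ¬ pair j u ∈ x) ∧ v = 0) := by
  by_cases h : ∃ u, pair j u ∈ x
  · obtain ⟨v, hv⟩ := exists_least (P := fun u => pair j u ∈ x) (by fun_prop) h
    exact ⟨v, Or.inl hv⟩
  · exact ⟨0, Or.inr ⟨not_exists.1 h, rfl⟩⟩

/-- The value at `j` of the function coded by a real. -/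
@[irreducible]
noncomputable def val (x : PowOmega M) (j : Omega M) : Omega M := (exists_value x j).choose

theorem val_eq_iff {x : PowOmega M} {j v : Omega M} : val x j = v ↔
    (pair j v ∈ x ∧ ∀ u, u < v → ¬ pair j u ∈ x) ∨ ((∀ u, ¬ pair j u ∈ x) ∧ v = 0) := by
  have h := (exists_value x j).choose_spec
  constructor
  · rintro rfl
    unfold val
    exact h
  · intro h'
    unfold val
    set w := (exists_value x j).choose
    rcases h with ⟨h1, h2⟩ | ⟨h1, h2⟩ <;> rcases h' with ⟨h3, h4⟩ | ⟨h3, h4⟩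
    · exact le_antisymm (not_lt.1 fun h => h2 _ h h3) (not_lt.1 fun h => h4 _ h h1)
    · exact (h3 _ h1).elim
    · exact (h1 _ h3).elim
    · rw [h2, h4]

@[fun_prop]
theorem dfn_val : Dfn M (fun p : PowOmega M × Omega M => val p.1 p.2) := by
  refine Dfn.of_graph ?_
  simp only [val_eq_iff]
  fun_prop

/-- The real coding a definable function. -/
noncomputable def ofFun (f : Omega M → Omega M) : PowOmega M := mk fun p => right p = f (left p)

theorem val_ofFun {f : Omega M → Omega M} (hf : Dfn M f) (j : Omega M) : val (ofFun f) j = f j := by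
  have h : ∀ p, p ∈ ofFun f ↔ right p = f (left p) := fun p => mem_mk (by fun_prop)
  rw [val_eq_iff]
  left
  simp only [h, left_pair, right_pair, true_and]
  exact fun u hu => hu.ne

@[fun_prop]
theorem dfn_ofFun {Γ : Type*} [DefType M Γ] {f : Γ → Omega M → Omega M}
    (hf : Dfn M (fun x : Γ × Omega M => f x.1 x.2)) :
    Dfn M (fun γ => ofFun (fun n => f γ n)) := by
  unfold ofFun
  fun_prop

@[fun_prop]
theorem _root_.SetModel.Dfn.ite {Γ Δ : Type*} [DefType M Γ] [DefType M Δ] {p : Γ → Prop}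
    [∀ x, Decidable (p x)] {f g : Γ → Δ} (hp : Dfn M p) (hf : Dfn M f) (hg : Dfn M g) :
    Dfn M (fun x => if p x then f x else g x) := by
  refine Dfn.of_graph ?_
  have : (fun q : Γ × Δ => (if p q.1 then f q.1 else g q.1) = q.2) =
      fun q => (p q.1 ∧ f q.1 = q.2) ∨ (¬ p q.1 ∧ g q.1 = q.2) := by
    funext q
    by_cases h : p q.1 <;> simp [h]
  rw [this]
  fun_prop

/-- Definition by recursion of a function on `ω`. -/
theorem exists_fun_recursion (a : Omega M) {S : Omega M → Omega M → Omega M}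
    (hS : Dfn M (fun x : Omega M × Omega M => S x.1 x.2)) :
    ∃ r : Omega M → Omega M, Dfn M r ∧ r 0 = a ∧ ∀ n, r (n + 1) = S n (r n) := by
  -- Iteration does not see the stage, so the stage is carried along as the first component.
  obtain ⟨r, h1, h2, h3⟩ := exists_iterate (pair 0 a)
    (S := fun p : Omega M => pair (left p + 1) (S (left p) (right p))) (by fun_prop)
  have h4 : ∀ n, left (r n) = n := by
    refine induction (by fun_prop) (by rw [h2, left_pair]) fun n hn => ?_
    rw [← succ_eq, h3, left_pair, hn, succ_eq]
  refine ⟨fun n => right (r n), by fun_prop, by simp [h2], fun n => ?_⟩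
  beta_reduce
  rw [← succ_eq, h3, right_pair, h4]

end PowOmega

end Reals

/-! ### Evaluation of oracle programs -/

section Evaluation

variable {M : Type*} [setLang.Structure M] [hM : ModelOfZF M]

open Omega PowOmega

/-- Values of the program of kind `i`, where `f` and `g` are the partial functions computed by
its two subprograms. -/
def Step (x : PowOmega M) (i : Omega M) (f g : Omega M → Omega M → Prop) (n v : Omega M) : Prop :=
  (i = 0 ∧ v = 0) ∨ (i = 1 ∧ v = n + 1) ∨ (i = 2 ∧ v = left n) ∨ (i = 3 ∧ v = right n) ∨
  (i = 4 ∧ ((n ∈ x ∧ v = 1) ∨ (¬ n ∈ x ∧ v = 0))) ∨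
  (i = 5 ∧ ∃ s t, f n s ∧ g n t ∧ v = pair s t) ∨
  (i = 6 ∧ ∃ s, g n s ∧ f s v) ∨
  (i = 7 ∧ ∃ w : PowOmega M, f (left n) (val w 0) ∧
    (∀ m, m < right n → g (pair (left n) (pair m (val w m))) (val w (m + 1))) ∧
    v = val w (right n)) ∨
  (i = 8 ∧ f (pair n v) 0 ∧ ∀ m, m < v → ∃ k, f (pair n m) k ∧ k ≠ 0)

@[fun_prop]
theorem dfn_step {Γ : Type*} [DefType M Γ] {x : Γ → PowOmega M} {i n v : Γ → Omega M}
    {f g : Γ → Omega M → Omega M → Prop} (hx : Dfn M x) (hi : Dfn M i) (hn : Dfn M n)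
    (hv : Dfn M v) (hf : Dfn M (fun p : Γ × Omega M × Omega M => f p.1 p.2.1 p.2.2))
    (hg : Dfn M (fun p : Γ × Omega M × Omega M => g p.1 p.2.1 p.2.2)) :
    Dfn M (fun γ => Step (x γ) (i γ) (f γ) (g γ) (n γ) (v γ)) := by
  unfold Step
  fun_prop

/-- One step of the course-of-values recursion defining `evalSeq`. -/
noncomputable def evalStep (x : PowOmega M) (c : Omega M) (y : PowOmega M) : PowOmega M :=
  mk fun p => Step x (left c) (fun n v => pair (left (right c)) (pair n v) ∈ y)
    (fun n v => pair (right (right c)) (pair n v) ∈ y) (left p) (right p)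

theorem dfn_evalStep :
    Dfn M (fun p : PowOmega M × Omega M × PowOmega M => evalStep p.1 p.2.1 p.2.2) := by
  unfold evalStep
  fun_prop

/-- The sequence of the graphs of the functions computed with oracle `x`. -/
noncomputable def evalSeq (x : PowOmega M) : PowOmega M := recSeq (evalStep x)

@[fun_prop]
theorem dfn_evalSeq : Dfn M (fun x : PowOmega M => evalSeq x) := dfn_recSeq dfn_evalStep

/-- `Ev x e n v`: the program with code `e` with oracle `x` maps `n` to `v`. -/
def Ev (x : PowOmega M) (e n v : Omega M) : Prop := pair e (pair n v) ∈ evalSeq x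

theorem dfn_ev' : Dfn M (fun p : PowOmega M × Omega M × Omega M × Omega M =>
    Ev p.1 p.2.1 p.2.2.1 p.2.2.2) := by
  unfold Ev
  fun_prop

@[fun_prop]
theorem dfn_ev {Γ : Type*} [DefType M Γ] {x : Γ → PowOmega M} {e n v : Γ → Omega M}
    (hx : Dfn M x) (he : Dfn M e) (hn : Dfn M n) (hv : Dfn M v) :
    Dfn M (fun γ => Ev (x γ) (e γ) (n γ) (v γ)) :=
  dfn_ev'.comp (hx.prodMk (he.prodMk (hn.prodMk hv)))

/-- The recursion sees only columns below the current code. For i ≠ 0 both subprograms have smaller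
codes, and for i = 0 the step ignores them. -/
theorem ev_iff {x : PowOmega M} {i a b n v : Omega M} :
    Ev x (pair i (pair a b)) n v ↔ Step x i (Ev x a) (Ev x b) n v := by
  have h1 : Dfn M (fun p : Omega M × PowOmega M => evalStep x p.1 p.2) :=
    dfn_evalStep.comp ((Dfn.const x).prodMk Dfn.id)
  unfold Ev
  rw [← mem_col, evalSeq, col_recSeq h1, ← evalSeq, evalStep, mem_mk (by fun_prop)]
  simp only [left_pair, right_pair]
  by_cases hi : i = 0
  · simp [Step, hi]
  · have hlt : pair a b < pair i (pair a b) := right_lt_pair (pos_iff_ne_zero.2 hi)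
    simp only [mem_restrict, left_pair, (left_le_pair a b).trans_lt hlt,
      (right_le_pair a b).trans_lt hlt, and_true]

theorem exists_pair_pair_eq (e : Omega M) : ∃ i a b, pair i (pair a b) = e :=
  ⟨left e, left (right e), right (right e), by simp⟩

/-- `x` and `y` agree below `s`. -/
def Agree (x y : PowOmega M) (s : Omega M) : Prop := ∀ j, j < s → (j ∈ x ↔ j ∈ y)

@[fun_prop]
theorem dfn_agree : Dfn M (fun p : PowOmega M × PowOmega M × Omega M =>
    Agree p.1 p.2.1 p.2.2) := by
  unfold Agree
  fun_prop

theorem Agree.mono {x y : PowOmega M} {s t : Omega M} (h : Agree x y t) (hs : s ≤ t) :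
    Agree x y s := fun j hj => h j (hj.trans_le hs)

/-- A computation only uses a finite part of its oracle. -/
theorem ev_continuous {x : PowOmega M} {e n v : Omega M} (h : Ev x e n v) :
    ∃ s, ∀ y, Agree x y s → Ev y e n v := by
  refine strong_induction (P := fun e => ∀ n v, Ev x e n v → ∃ s, ∀ y, Agree x y s → Ev y e n v)
    (by fun_prop) ?_ e n v h
  intro e ih n v h
  obtain ⟨i, a, b, rfl⟩ := exists_pair_pair_eq e
  have iha : i ≠ 0 → ∀ n v, Ev x a n v → ∃ s, ∀ y, Agree x y s → Ev y a n v := fun hi =>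
    ih a ((left_le_pair a b).trans_lt (right_lt_pair (pos_iff_ne_zero.2 hi)))
  have ihb : i ≠ 0 → ∀ n v, Ev x b n v → ∃ s, ∀ y, Agree x y s → Ev y b n v := fun hi =>
    ih b ((right_le_pair a b).trans_lt (right_lt_pair (pos_iff_ne_zero.2 hi)))
  have hmono : ∀ e n v s t, s ≤ t → (∀ y, Agree x y s → Ev y e n v) →
      ∀ y, Agree x y t → Ev y e n v := fun _ _ _ s t hs h y hy => h y (hy.mono hs)
  clear ih
  simp only [ev_iff] at h ⊢
  rcases h with h | h | h | h | h | h | h | h | h <;> obtain ⟨rfl, h⟩ := h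
  · exact ⟨0, fun y _ => by simp [Step, h]⟩
  · exact ⟨0, fun y _ => by simp [Step, h]⟩
  · exact ⟨0, fun y _ => by simp [Step, h]⟩
  · exact ⟨0, fun y _ => by simp [Step, h]⟩
  · refine ⟨n + 1, fun y hy => ?_⟩
    rw [hy n (lt_add_one n)] at h
    simp [Step, h]
  · obtain ⟨s, t, h1, h2, rfl⟩ := h
    obtain ⟨s1, hs1⟩ := iha (by simp) _ _ h1
    obtain ⟨s2, hs2⟩ := ihb (by simp) _ _ h2
    refine ⟨max s1 s2, fun y hy => ?_⟩
    iterate 5 right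
    left
    exact ⟨rfl, s, t, hs1 y (hy.mono (le_max_left _ _)), hs2 y (hy.mono (le_max_right _ _)), rfl⟩
  · obtain ⟨s, h1, h2⟩ := h
    obtain ⟨s1, hs1⟩ := ihb (by simp) _ _ h1
    obtain ⟨s2, hs2⟩ := iha (by simp) _ _ h2
    refine ⟨max s1 s2, fun y hy => ?_⟩
    iterate 6 right
    left
    exact ⟨rfl, s, hs1 y (hy.mono (le_max_left _ _)), hs2 y (hy.mono (le_max_right _ _))⟩
  · obtain ⟨w, h1, h2, rfl⟩ := h
    obtain ⟨s1, hs1⟩ := iha (by simp) _ _ h1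
    -- A primitive recursion makes right n many calls, possibly a nonstandard number. Their uses are
    -- bounded together by induction in M.
    obtain ⟨s2, hs2⟩ := exists_bound (P := fun m s => ∀ y, Agree x y s →
        Ev y b (pair (left n) (pair m (val w m))) (val w (m + 1))) (by fun_prop)
      (fun m s t => hmono _ _ _ s t) (right n) fun m hm => ihb (by simp) _ _ (h2 m hm)
    refine ⟨max s1 s2, fun y hy => ?_⟩
    iterate 7 right
    left
    exact ⟨rfl, w, hs1 y (hy.mono (le_max_left _ _)),
      fun m hm => hs2 m hm y (hy.mono (le_max_right _ _)), rfl⟩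
  · obtain ⟨h1, h2⟩ := h
    obtain ⟨s1, hs1⟩ := iha (by simp) _ _ h1
    obtain ⟨s2, hs2⟩ := exists_bound (P := fun m s => ∃ k, k ≠ 0 ∧ ∀ y, Agree x y s →
        Ev y a (pair n m) k) (by fun_prop)
      (fun m s t hst ⟨k, hk, h⟩ => ⟨k, hk, hmono _ _ _ s t hst h⟩) v fun m hm => by
        obtain ⟨k, hk, hk0⟩ := h2 m hm
        obtain ⟨s, hs⟩ := iha (by simp) _ _ hk
        exact ⟨s, k, hk0, hs⟩
    refine ⟨max s1 s2, fun y hy => ?_⟩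
    iterate 8 right
    refine ⟨rfl, hs1 y (hy.mono (le_max_left _ _)), fun m hm => ?_⟩
    obtain ⟨k, hk, hs⟩ := hs2 m hm
    exact ⟨k, hs y (hy.mono (le_max_right _ _)), hk⟩

end Evaluation

/-! ### Relative recursiveness -/

section Recursive

variable {M : Type*} [setLang.Structure M]

theorem isRecClosed_iff {o C : M} : IsRecClosed o C ↔
    (∀ h, IsPartFun h → (∀ a b, App h a b ↔ IsNat a ∧ IsZero b) → h ∈ₘ C) ∧
    (∀ h, IsPartFun h → (∀ a b, App h a b ↔ IsNat a ∧ IsSucc b a) → h ∈ₘ C) ∧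
    (∀ h, IsPartFun h → (∀ p b, App h p b ↔ ∃ c, IsNatPair b c p) → h ∈ₘ C) ∧
    (∀ h, IsPartFun h → (∀ p c, App h p c ↔ ∃ b, IsNatPair b c p) → h ∈ₘ C) ∧
    o ∈ₘ C ∧
    (∀ f g h, f ∈ₘ C → g ∈ₘ C → IsPartFun h →
      (∀ a d, App h a d ↔ ∃ b c, App f a b ∧ App g a c ∧ IsNatPair b c d) → h ∈ₘ C) ∧
    (∀ f g h, f ∈ₘ C → g ∈ₘ C → IsPartFun h →
      (∀ a c, App h a c ↔ ∃ b, App g a b ∧ App f b c) → h ∈ₘ C) ∧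
    (∀ f g h, f ∈ₘ C → g ∈ₘ C → IsPartFun h →
      (∀ a z p, IsZero z → IsNatPair a z p → ∀ b, App h p b ↔ App f a b) →
      (∀ a n n' p p', IsSucc n' n → IsNatPair a n p → IsNatPair a n' p' → ∀ b,
        App h p' b ↔ ∃ i q r, App h p i ∧ IsNatPair n i q ∧ IsNatPair a q r ∧ App g r b) →
      h ∈ₘ C) ∧
    (∀ f h, f ∈ₘ C → IsPartFun h →
      (∀ a n, App h a n ↔ (∃ p z, IsNatPair a n p ∧ IsZero z ∧ App f p z) ∧
        ∀ m, m ∈ₘ n → ∃ p k, IsNatPair a m p ∧ App f p k ∧ ¬ IsZero k) →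
      h ∈ₘ C) :=
  ⟨fun ⟨h1, h2, h3, h4, h5, h6, h7, h8, h9⟩ => ⟨h1, h2, h3, h4, h5, h6, h7, h8, h9⟩,
    fun ⟨h1, h2, h3, h4, h5, h6, h7, h8, h9⟩ => ⟨h1, h2, h3, h4, h5, h6, h7, h8, h9⟩⟩

/-- A set recursive in an oracle which is recursive in another one. -/
theorem IsRecursiveIn.trans {f g o : M} (hf : IsRecursiveIn g f) (hg : IsRecursiveIn o g) :
    IsRecursiveIn o f :=
  ⟨hf.1, fun C hC => hf.2 C ⟨hC.zero, hC.succ, hC.left, hC.right, hg.2 C hC, hC.pair, hC.comp,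
    hC.prec, hC.rfind⟩⟩

variable [hM : ModelOfZF M]

open Omega PowOmega

@[fun_prop]
theorem dfn_isRecClosed : Dfn M (fun p : M × M => IsRecClosed p.1 p.2) := by
  simp only [isRecClosed_iff]
  fun_prop

@[fun_prop]
theorem dfn_isRecursiveIn : Dfn M (fun p : M × M => IsRecursiveIn p.1 p.2) := by
  unfold IsRecursiveIn
  fun_prop

@[fun_prop]
theorem dfn_isCharFun : Dfn M (fun p : M × M => IsCharFun p.1 p.2) := by
  unfold IsCharFun
  fun_prop

@[fun_prop]
theorem dfn_turingLE : Dfn M (fun p : M × M => TuringLE p.1 p.2) := by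
  unfold TuringLE
  fun_prop

theorem IsPartFun.ext {f g : M} (hf : IsPartFun f) (hg : IsPartFun g)
    (h : ∀ n v : Omega M, App f n.1 v.1 ↔ App g n.1 v.1) : f = g := by
  have key : ∀ f g : M, IsPartFun f → (∀ n v : Omega M, App f n.1 v.1 → App g n.1 v.1) →
      ∀ p, p ∈ₘ f → p ∈ₘ g := by
    intro f g hf h p hp
    obtain ⟨a, b, ha, hb, hp'⟩ := hf.1 p hp
    obtain ⟨q, hq, hqg⟩ := h ⟨a, ha⟩ ⟨b, hb⟩ ⟨p, hp', hp⟩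
    rwa [hp'.eq hq]
  exact set_ext fun p => ⟨key f g hf (fun n v => (h n v).1) p, key g f hg (fun n v => (h n v).2) p⟩

open Classical in
/-- The characteristic function of a real. -/
noncomputable def PowOmega.char (x : PowOmega M) (n : Omega M) : Omega M := if n ∈ x then 1 else 0

@[fun_prop]
theorem dfn_char : Dfn M (fun p : PowOmega M × Omega M => char p.1 p.2) := by
  unfold char
  fun_prop

theorem char_eq_one {x : PowOmega M} {n : Omega M} : char x n = 1 ↔ n ∈ x := by
  unfold char
  split_ifs with h <;> simp [h]

theorem char_eq_zero {x : PowOmega M} {n : Omega M} : char x n = 0 ↔ n ∉ x := by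
  unfold char
  split_ifs with h <;> simp [h]

theorem char_congr {x y : PowOmega M} {m n : Omega M} (h : m ∈ x ↔ n ∈ y) :
    char x m = char y n := by
  by_cases hn : n ∈ y
  · rw [char_eq_one.2 hn, char_eq_one.2 (h.2 hn)]
  · rw [char_eq_zero.2 hn, char_eq_zero.2 (mt h.1 hn)]

theorem isOne_iff {n : Omega M} : IsOne n.1 ↔ n = 1 := by
  constructor
  · rintro ⟨z, hz, h⟩
    rw [hz.eq isZero_zero, isSucc_iff, succ_eq, zero_add] at h
    exact h
  · rintro rfl
    refine ⟨_, isZero_zero, ?_⟩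
    rw [isSucc_iff, succ_eq, zero_add]

theorem isCharFun_iff {f : M} {x : PowOmega M} : IsCharFun f x.1 ↔
    IsPartFun f ∧ ∀ n v : Omega M, App f n.1 v.1 ↔ char x n = v := by
  have key : ∀ n v : Omega M, (IsNat n.1 ∧ ((n.1 ∈ₘ x.1 ∧ IsOne v.1) ∨ (¬ n.1 ∈ₘ x.1 ∧ IsZero v.1)))
      ↔ char x n = v := by
    intro n v
    have h0 : n.1 ∈ₘ x.1 ↔ n ∈ x := Iff.rfl
    rw [isOne_iff, isZero_iff, h0]
    unfold char
    by_cases h : n ∈ x <;> simp [h, n.2, eq_comm]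
  refine and_congr_right fun hf => ⟨fun h n v => (h n.1 v.1).trans (key n v), fun h n b => ?_⟩
  constructor
  · intro h1
    obtain ⟨n, v, rfl, rfl⟩ := app_nat hf.1 h1
    exact (key n v).2 ((h n v).1 h1)
  · rintro ⟨hn, h1⟩
    have hb : IsNat b := by
      rcases h1 with ⟨-, z, hz, hb⟩ | ⟨-, hb⟩
      · exact (IsNat.of_isZero hz).of_isSucc hb
      · exact IsNat.of_isZero hb
    exact (h ⟨n, hn⟩ ⟨b, hb⟩).2 ((key ⟨n, hn⟩ ⟨b, hb⟩).1 ⟨hn, h1⟩)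

theorem exists_isCharFun (x : PowOmega M) : ∃ f, IsCharFun f x.1 := by
  obtain ⟨f, h1, h2⟩ := exists_partFun (M := M) (φ := fun n v => char x n = v) (by fun_prop)
    (by rintro a b b' rfl rfl; rfl)
  exact ⟨f, isCharFun_iff.2 ⟨h1, h2⟩⟩

theorem IsCharFun.unique {f g : M} {x : PowOmega M} (hf : IsCharFun f x.1) (hg : IsCharFun g x.1) :
    f = g := by
  rw [isCharFun_iff] at hf hg
  exact hf.1.ext hg.1 fun n v => (hf.2 n v).trans (hg.2 n v).symm

theorem turingLE_trans {x y z : PowOmega M} (h : TuringLE x.1 y.1) (h' : TuringLE y.1 z.1) :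
    TuringLE x.1 z.1 := by
  obtain ⟨f, g, hf, hg, h⟩ := h
  obtain ⟨g', o, hg', ho, h'⟩ := h'
  obtain rfl := hg.unique hg'
  exact ⟨f, o, hf, ho, h.trans h'⟩

/-! ### Recursive functions have codes -/

/-- All partial functions from ω to ω are subsets of the one set ω × ω, so separation from its power
set applies. -/
theorem exists_partFun_set {P : M → Prop} (hP : Dfn M P) :
    ∃ C : M, ∀ f, f ∈ₘ C ↔ IsPartFun f ∧ P f := by
  obtain ⟨q, -, hq⟩ := Omega.exists_graph (M := M) (φ := fun _ _ => True) (by fun_prop)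
  obtain ⟨r, hr⟩ := hM.out.powerset q
  obtain ⟨C, hC⟩ := separation (M := M) (P := fun f => IsPartFun f ∧ P f) (by fun_prop) r
  refine ⟨C, fun f => (hC f).trans ⟨fun h => h.2, fun h => ⟨(hr f).2 fun p hp => ?_, h⟩⟩⟩
  obtain ⟨a, b, ha, hb, h1⟩ := h.1.1 p hp
  obtain ⟨p', hp', h2⟩ := (hq ⟨a, ha⟩ ⟨b, hb⟩).2 trivial
  rwa [h1.eq hp']

theorem IsNatPair.exists_omega {a b c : M} (h : IsNatPair a b c) :
    ∃ m n : Omega M, m.1 = a ∧ n.1 = b ∧ (pair m n).1 = c :=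
  ⟨⟨a, h.1⟩, ⟨b, h.2.1⟩, rfl, rfl,
    congrArg Subtype.val (isNatPair_iff (c := ⟨c, h.2.2.1⟩).1 h)⟩

/-- The partial function `f` is computed by the program with code `e` and oracle `x`. -/
def HasCode (x : PowOmega M) (f : M) (e : Omega M) : Prop :=
  ∀ n v : Omega M, App f n.1 v.1 ↔ Ev x e n v

theorem hasCode_prec {x : PowOmega M} {f g h : M} {a b : Omega M}
    (hf : HasCode x f a) (hg : HasCode x g b) (hhp : IsPartFun h)
    (h0 : ∀ a z p, IsZero z → IsNatPair a z p → ∀ b, App h p b ↔ App f a b)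
    (hs : ∀ a n n' p p', IsSucc n' n → IsNatPair a n p → IsNatPair a n' p' → ∀ b,
      App h p' b ↔ ∃ i q r, App h p i ∧ IsNatPair n i q ∧ IsNatPair a q r ∧ App g r b) :
    HasCode x h (pair 7 (pair a b)) := by
  have h0' : ∀ m v : Omega M, App h (pair m 0).1 v.1 ↔ Ev x a m v := fun m v =>
    (h0 _ _ _ isZero_zero (isNatPair_iff.2 rfl) _).trans (hf m v)
  have hs' : ∀ m n v : Omega M, App h (pair m (n + 1)).1 v.1 ↔
      ∃ i : Omega M, App h (pair m n).1 i.1 ∧ Ev x b (pair m (pair n i)) v := by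
    intro m n v
    rw [hs _ _ _ _ _ (isSucc_add_one n) (isNatPair_iff.2 rfl) (isNatPair_iff.2 rfl)]
    constructor
    · rintro ⟨i, q, r, h1, h2, h3, h4⟩
      obtain ⟨_, i, -, rfl⟩ := app_nat hhp.1 h1
      obtain ⟨n', i', h5, h6, rfl⟩ := h2.exists_omega
      obtain ⟨m', q', h7, h8, rfl⟩ := h3.exists_omega
      obtain rfl := Subtype.ext h5
      obtain rfl := Subtype.ext h6
      obtain rfl := Subtype.ext h7
      obtain rfl := Subtype.ext h8
      exact ⟨_, h1, (hg _ _).1 h4⟩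
    · rintro ⟨i, h1, h2⟩
      exact ⟨_, _, _, h1, isNatPair_iff.2 rfl, isNatPair_iff.2 rfl, (hg _ _).2 h2⟩
  -- The recursion on n is matched with histories w of all values up to n. In the inductive step a
  -- history is prolonged by v.
  have key : ∀ m n v : Omega M, App h (pair m n).1 v.1 ↔ ∃ w : PowOmega M, Ev x a m (val w 0) ∧
      (∀ k, k < n → Ev x b (pair m (pair k (val w k))) (val w (k + 1))) ∧ v = val w n := by
    intro m
    refine induction (by fun_prop) (fun v => ?_) fun n ih v => ?_
    · rw [h0']
      constructor
      · intro h
        refine ⟨ofFun fun _ => v, ?_, fun k hk => (not_lt_zero hk).elim, ?_⟩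
        · rwa [val_ofFun (by fun_prop)]
        · rw [val_ofFun (by fun_prop)]
      · rintro ⟨w, h1, -, rfl⟩
        exact h1
    · rw [hs']
      constructor
      · rintro ⟨i, h1, h2⟩
        obtain ⟨w, h3, h4, rfl⟩ := (ih i).1 h1
        classical
        let w' : PowOmega M := ofFun fun k => if k ≤ n then val w k else v
        have hw' : ∀ k, val w' k = if k ≤ n then val w k else v := fun k =>
          val_ofFun (by fun_prop) k
        have hn : ¬ n + 1 ≤ n := (lt_add_one n).not_ge
        refine ⟨w', ?_, fun k hk => ?_, ?_⟩
        · rw [hw', if_pos zero_le]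
          exact h3
        · rw [hw', hw', if_pos (lt_add_one_iff.1 hk)]
          rcases (lt_add_one_iff.1 hk).lt_or_eq with hk | rfl
          · rw [if_pos (add_one_le_iff.2 hk)]
            exact h4 k hk
          · rw [if_neg hn]
            exact h2
        · rw [hw', if_neg hn]
      · rintro ⟨w, h1, h2, rfl⟩
        exact ⟨val w n, (ih _).2 ⟨w, h1, fun k hk => h2 k (hk.trans (lt_add_one n)), rfl⟩,
          h2 n (lt_add_one n)⟩
  intro n v
  obtain ⟨m, n, rfl⟩ : ∃ k l, pair k l = n := exists_pair_eq n
  rw [key, ev_iff]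
  simp [Step]

/-- Membership in every closed set implies membership in this one, so each function recursive in x
has a program. This replaces the closure definition by the evaluation relation `Ev`. -/
theorem isRecClosed_of_hasCode {x : PowOmega M} {o C : M} (ho : IsCharFun o x.1)
    (hC : ∀ f, f ∈ₘ C ↔ IsPartFun f ∧ ∃ e, HasCode x f e) : IsRecClosed o C where
  zero h hp hh := (hC h).2 ⟨hp, pair 0 (pair 0 0), fun n v => by
    rw [hh, ev_iff, isZero_iff]
    simp [Step, n.2]⟩
  succ h hp hh := (hC h).2 ⟨hp, pair 1 (pair 0 0), fun n v => by
    rw [hh, ev_iff, isSucc_iff, succ_eq]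
    simp [Step, n.2]⟩
  left h hp hh := (hC h).2 ⟨hp, pair 2 (pair 0 0), fun n v => by
    have : Ev x (pair 2 (pair 0 0)) n v ↔ v = Omega.left n := by
      rw [ev_iff]
      simp [Step]
    rw [this, hh]
    constructor
    · rintro ⟨c, hc⟩
      obtain ⟨m, k, h1, -, h3⟩ := hc.exists_omega
      rw [← Subtype.ext h3, left_pair]
      exact (Subtype.ext h1).symm
    · rintro rfl
      exact ⟨(Omega.right n).1, isNatPair_iff.2 (pair_left_right n)⟩⟩
  right h hp hh := (hC h).2 ⟨hp, pair 3 (pair 0 0), fun n v => by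
    have : Ev x (pair 3 (pair 0 0)) n v ↔ v = Omega.right n := by
      rw [ev_iff]
      simp [Step]
    rw [this, hh]
    constructor
    · rintro ⟨c, hc⟩
      obtain ⟨m, k, -, h2, h3⟩ := hc.exists_omega
      rw [← Subtype.ext h3, right_pair]
      exact (Subtype.ext h2).symm
    · rintro rfl
      exact ⟨(Omega.left n).1, isNatPair_iff.2 (pair_left_right n)⟩⟩
  oracle := by
    rw [isCharFun_iff] at ho
    refine (hC o).2 ⟨ho.1, pair 4 (pair 0 0), fun n v => ?_⟩
    rw [ho.2, ev_iff]
    unfold char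
    by_cases h : n ∈ x <;> simp [Step, h, eq_comm]
  pair f g h hf hg hp hh := by
    obtain ⟨hfp, a, ha⟩ := (hC f).1 hf
    obtain ⟨hgp, b, hb⟩ := (hC g).1 hg
    refine (hC h).2 ⟨hp, pair 5 (pair a b), fun n v => ?_⟩
    have : Ev x (Omega.pair 5 (Omega.pair a b)) n v ↔
        ∃ s t, Ev x a n s ∧ Ev x b n t ∧ v = Omega.pair s t := by
      rw [ev_iff]
      simp [Step]
    rw [this, hh]
    constructor
    · rintro ⟨s, t, h1, h2, h3⟩
      obtain ⟨s, t, rfl, rfl, h4⟩ := h3.exists_omega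
      exact ⟨s, t, (ha _ _).1 h1, (hb _ _).1 h2, (Subtype.ext h4).symm⟩
    · rintro ⟨s, t, h1, h2, rfl⟩
      exact ⟨s.1, t.1, (ha _ _).2 h1, (hb _ _).2 h2, isNatPair_iff.2 rfl⟩
  comp f g h hf hg hp hh := by
    obtain ⟨hfp, a, ha⟩ := (hC f).1 hf
    obtain ⟨hgp, b, hb⟩ := (hC g).1 hg
    refine (hC h).2 ⟨hp, pair 6 (pair a b), fun n v => ?_⟩
    have : Ev x (Omega.pair 6 (Omega.pair a b)) n v ↔ ∃ s, Ev x b n s ∧ Ev x a s v := by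
      rw [ev_iff]
      simp [Step]
    rw [this, hh]
    constructor
    · rintro ⟨s, h1, h2⟩
      obtain ⟨_, s, -, rfl⟩ := app_nat hgp.1 h1
      exact ⟨s, (hb _ _).1 h1, (ha _ _).1 h2⟩
    · rintro ⟨s, h1, h2⟩
      exact ⟨s.1, (hb _ _).2 h1, (ha _ _).2 h2⟩
  prec f g h hf hg hp h0 hs := by
    obtain ⟨hfp, a, ha⟩ := (hC f).1 hf
    obtain ⟨hgp, b, hb⟩ := (hC g).1 hg
    exact (hC h).2 ⟨hp, _, hasCode_prec ha hb hp h0 hs⟩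
  rfind f h hf hp hh := by
    obtain ⟨hfp, a, ha⟩ := (hC f).1 hf
    refine (hC h).2 ⟨hp, pair 8 (pair a 0), fun n v => ?_⟩
    have : Ev x (Omega.pair 8 (Omega.pair a 0)) n v ↔ Ev x a (Omega.pair n v) 0 ∧
        ∀ m, m < v → ∃ k, Ev x a (Omega.pair n m) k ∧ k ≠ 0 := by
      rw [ev_iff]
      simp [Step]
    rw [this, hh]
    refine and_congr ⟨?_, fun h1 => ?_⟩ ⟨fun H m hm => ?_, fun H m hm => ?_⟩
    · rintro ⟨p, z, h1, h2, h3⟩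
      obtain ⟨n', v', h4, h5, rfl⟩ := h1.exists_omega
      obtain rfl := Subtype.ext h4
      obtain rfl := Subtype.ext h5
      rw [h2.eq isZero_zero] at h3
      exact (ha _ _).1 h3
    · exact ⟨_, _, isNatPair_iff.2 rfl, isZero_zero, (ha _ _).2 h1⟩
    · obtain ⟨p, k, h1, h2, h3⟩ := H m.1 (mem_iff_lt.2 hm)
      obtain ⟨n', m', h4, h5, rfl⟩ := h1.exists_omega
      obtain rfl := Subtype.ext h4
      obtain rfl := Subtype.ext h5
      obtain ⟨_, k, -, rfl⟩ := app_nat hfp.1 h2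
      exact ⟨k, (ha _ _).1 h2, fun h => h3 (isZero_iff.2 h)⟩
    · obtain ⟨m, rfl⟩ : ∃ m' : Omega M, m'.1 = m := ⟨⟨m, mem_of_mem_isNat v hm⟩, rfl⟩
      obtain ⟨k, h1, h2⟩ := H m (mem_iff_lt.1 hm)
      exact ⟨_, k.1, isNatPair_iff.2 rfl, (ha _ _).2 h1, fun h => h2 (isZero_iff.1 h)⟩

theorem IsRecursiveIn.exists_code {x : PowOmega M} {o f : M} (ho : IsCharFun o x.1)
    (h : IsRecursiveIn o f) : ∃ e, ∀ n v : Omega M, App f n.1 v.1 ↔ Ev x e n v := by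
  obtain ⟨C, hC⟩ := exists_partFun_set (M := M) (P := fun f => ∃ e, HasCode x f e) (by
    unfold HasCode
    fun_prop)
  exact ((hC f).1 (h.2 C (isRecClosed_of_hasCode ho hC))).2

theorem TuringLE.exists_code {x y : PowOmega M} (h : TuringLE y.1 x.1) :
    ∃ e, ∀ n, n ∈ y ↔ Ev x e n 1 := by
  obtain ⟨f, g, hf, hg, h⟩ := h
  obtain ⟨e, he⟩ := h.exists_code hg
  refine ⟨e, fun n => ?_⟩
  rw [← he, (isCharFun_iff.1 hf).2, char_eq_one]

/-! ### Computable functions -/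

/-- The total function `F` belongs to every recursively closed set containing the
characteristic function of `x`. -/
def ComputableIn (x : PowOmega M) (F : Omega M → Omega M) : Prop :=
  ∀ o C : M, IsCharFun o x.1 → IsRecClosed o C →
    ∃ f, f ∈ₘ C ∧ IsPartFun f ∧ ∀ n v : Omega M, App f n.1 v.1 ↔ F n = v

theorem exists_partFun_graph {F : Omega M → Omega M} (hF : Dfn M F) :
    ∃ f : M, IsPartFun f ∧ ∀ n v : Omega M, App f n.1 v.1 ↔ F n = v :=
  exists_partFun (M := M) (φ := fun n v => F n = v) (by fun_prop)
    (by rintro a b b' rfl rfl; rfl)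

namespace ComputableIn

variable {x : PowOmega M} {F G : Omega M → Omega M}

/-- Applied to one particular closed set, the hypothesis makes the graph of F a set of the model,
which then serves as a parameter. -/
theorem dfn (hF : ComputableIn x F) : Dfn M F := by
  obtain ⟨o, ho⟩ := exists_isCharFun x
  obtain ⟨C, hC⟩ := exists_partFun_set (M := M) (P := fun f => ∃ e, HasCode x f e) (by
    unfold HasCode
    fun_prop)
  obtain ⟨f, -, -, h⟩ := hF o C ho (isRecClosed_of_hasCode ho hC)
  refine Dfn.of_graph ?_
  simp only [← h]
  fun_prop

/-- Induction inside M on c, composing with the successor. The constant may be nonstandard, so no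
external iteration would reach it. -/
theorem const (c : Omega M) : ComputableIn x (fun _ => c) := by
  intro o C ho hC
  refine induction (P := fun c => ∃ f, f ∈ₘ C ∧ IsPartFun f ∧
    ∀ n v : Omega M, App f n.1 v.1 ↔ c = v) (by fun_prop) ?_ (fun c => ?_) c
  · obtain ⟨f, h1, h2⟩ := exists_partFun_graph (M := M) (F := fun _ => 0) (by fun_prop)
    refine ⟨f, hC.zero f h1 fun a b => ⟨fun h => ?_, fun ⟨h, h'⟩ => ?_⟩, h1, h2⟩
    · obtain ⟨n, v, rfl, rfl⟩ := app_nat h1.1 h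
      exact ⟨n.2, isZero_iff.2 ((h2 n v).1 h).symm⟩
    · exact (h2 ⟨a, h⟩ ⟨b, IsNat.of_isZero h'⟩).2
        (isZero_iff (n := ⟨b, IsNat.of_isZero h'⟩).1 h').symm
  · rintro ⟨f, h1, h2, h3⟩
    obtain ⟨s, h4, h5⟩ := exists_partFun_graph (M := M) (F := fun n => n + 1) (by fun_prop)
    obtain ⟨g, h6, h7⟩ := exists_partFun_graph (M := M) (F := fun _ => c + 1) (by fun_prop)
    have hs : s ∈ₘ C := by
      refine hC.succ s h4 fun a b => ⟨fun h => ?_, fun ⟨h, h'⟩ => ?_⟩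
      · obtain ⟨n, v, rfl, rfl⟩ := app_nat h4.1 h
        exact ⟨n.2, (h5 n v).1 h ▸ isSucc_add_one n⟩
      · rw [h'.eq (isSucc_add_one ⟨a, h⟩)]
        exact (h5 ⟨a, h⟩ _).2 rfl
    refine ⟨g, hC.comp s f g hs h1 h6 fun a b => ⟨fun h => ?_, fun ⟨k, h, h'⟩ => ?_⟩, h6, h7⟩
    · obtain ⟨n, v, rfl, rfl⟩ := app_nat h6.1 h
      exact ⟨c.1, (h3 n c).2 rfl, (h5 c v).2 ((h7 n v).1 h)⟩
    · obtain ⟨n, c', rfl, rfl⟩ := app_nat h2.1 h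
      obtain ⟨_, v, -, rfl⟩ := app_nat h4.1 h'
      rw [h7, ← (h5 c' v).1 h', (h3 n c').1 h]

theorem comp (hF : ComputableIn x F) (hG : ComputableIn x G) :
    ComputableIn x (fun n => F (G n)) := by
  have hF' := hF.dfn
  have hG' := hG.dfn
  intro o C ho hC
  obtain ⟨f, h1, h2, h3⟩ := hF o C ho hC
  obtain ⟨g, h4, h5, h6⟩ := hG o C ho hC
  obtain ⟨h, h7, h8⟩ := exists_partFun_graph (M := M) (F := fun n => F (G n)) (by fun_prop)
  refine ⟨h, hC.comp f g h h1 h4 h7 fun a b => ⟨fun H => ?_, fun ⟨k, H, H'⟩ => ?_⟩, h7, h8⟩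
  · obtain ⟨n, v, rfl, rfl⟩ := app_nat h7.1 H
    exact ⟨(G n).1, (h6 _ _).2 rfl, (h3 _ _).2 ((h8 n v).1 H)⟩
  · obtain ⟨n, k, rfl, rfl⟩ := app_nat h5.1 H
    obtain ⟨_, v, -, rfl⟩ := app_nat h2.1 H'
    rw [h8, (h6 n k).1 H, (h3 k v).1 H']

theorem pair (hF : ComputableIn x F) (hG : ComputableIn x G) :
    ComputableIn x (fun n => Omega.pair (F n) (G n)) := by
  have hF' := hF.dfn
  have hG' := hG.dfn
  intro o C ho hC
  obtain ⟨f, h1, h2, h3⟩ := hF o C ho hC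
  obtain ⟨g, h4, h5, h6⟩ := hG o C ho hC
  obtain ⟨h, h7, h8⟩ := exists_partFun_graph (M := M) (F := fun n => Omega.pair (F n) (G n))
    (by fun_prop)
  refine ⟨h, hC.pair f g h h1 h4 h7 fun a b => ⟨fun H => ?_, fun ⟨s, t, H, H', H2⟩ => ?_⟩, h7, h8⟩
  · obtain ⟨n, v, rfl, rfl⟩ := app_nat h7.1 H
    exact ⟨(F n).1, (G n).1, (h3 _ _).2 rfl, (h6 _ _).2 rfl, isNatPair_iff.2 ((h8 n v).1 H)⟩
  · obtain ⟨n, s, rfl, rfl⟩ := app_nat h2.1 H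
    obtain ⟨s', t, h9, rfl, rfl⟩ := H2.exists_omega
    obtain rfl := Subtype.ext h9
    rw [h8, (h3 _ _).1 H, (h6 _ _).1 H']

theorem add_one : ComputableIn x (fun n => n + 1) := by
  intro o C ho hC
  obtain ⟨s, h4, h5⟩ := exists_partFun_graph (M := M) (F := fun n => n + 1) (by fun_prop)
  refine ⟨s, hC.succ s h4 fun a b => ⟨fun h => ?_, fun ⟨h, h'⟩ => ?_⟩, h4, h5⟩
  · obtain ⟨n, v, rfl, rfl⟩ := app_nat h4.1 h
    exact ⟨n.2, (h5 n v).1 h ▸ isSucc_add_one n⟩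
  · rw [h'.eq (isSucc_add_one ⟨a, h⟩)]
    exact (h5 ⟨a, h⟩ _).2 rfl

theorem left : ComputableIn x (fun n => Omega.left n) := by
  intro o C ho hC
  obtain ⟨s, h4, h5⟩ := exists_partFun_graph (M := M) (F := fun n => Omega.left n) (by fun_prop)
  refine ⟨s, hC.left s h4 fun a b => ⟨fun h => ?_, fun ⟨c, h⟩ => ?_⟩, h4, h5⟩
  · obtain ⟨n, v, rfl, rfl⟩ := app_nat h4.1 h
    rw [h5] at h
    exact ⟨(Omega.right n).1, isNatPair_iff.2 (h ▸ pair_left_right n)⟩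
  · obtain ⟨m, k, rfl, rfl, rfl⟩ := h.exists_omega
    rw [h5, left_pair]

theorem right : ComputableIn x (fun n => Omega.right n) := by
  intro o C ho hC
  obtain ⟨s, h4, h5⟩ := exists_partFun_graph (M := M) (F := fun n => Omega.right n) (by fun_prop)
  refine ⟨s, hC.right s h4 fun a b => ⟨fun h => ?_, fun ⟨c, h⟩ => ?_⟩, h4, h5⟩
  · obtain ⟨n, v, rfl, rfl⟩ := app_nat h4.1 h
    rw [h5] at h
    exact ⟨(Omega.left n).1, isNatPair_iff.2 (h ▸ pair_left_right n)⟩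
  · obtain ⟨m, k, rfl, rfl, rfl⟩ := h.exists_omega
    rw [h5, right_pair]

theorem char : ComputableIn x (PowOmega.char x) := by
  intro o C ho hC
  obtain ⟨h1, h2⟩ := isCharFun_iff.1 ho
  exact ⟨o, hC.oracle, h1, h2⟩

theorem isRecursiveIn {f o : M} (hF : ComputableIn x F) (ho : IsCharFun o x.1) (hf : IsPartFun f)
    (h : ∀ n v : Omega M, App f n.1 v.1 ↔ F n = v) : IsRecursiveIn o f := by
  refine ⟨hf, fun C hC => ?_⟩
  obtain ⟨g, h1, h2, h3⟩ := hF o C ho hC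
  rwa [hf.ext h2 fun n v => (h n v).trans (h3 n v).symm]

theorem turingLE {y : PowOmega M} (h : ComputableIn x (PowOmega.char y)) :
    TuringLE y.1 x.1 := by
  obtain ⟨f, hf⟩ := exists_isCharFun y
  obtain ⟨o, ho⟩ := exists_isCharFun x
  obtain ⟨h1, h2⟩ := isCharFun_iff.1 hf
  exact ⟨f, o, hf, ho, h.isRecursiveIn ho h1 h2⟩

end ComputableIn

theorem turingLE_refl (x : PowOmega M) : TuringLE x.1 x.1 := ComputableIn.char.turingLE

/-! ### Limits of recursive functions -/

/-- For some partial function `f` recursive in `x`, the real `y` consists of the `n` such that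
`f⟨n, s⟩ = 0` for boundedly many `s` only. -/
def LimitBelow (y x : PowOmega M) : Prop :=
  ∃ f o, IsCharFun o x.1 ∧ IsRecursiveIn o f ∧
    ∀ n, n ∈ y ↔ ∃ s, ∀ t, s ≤ t → ¬ App f (pair n t).1 (0 : Omega M).1

@[fun_prop]
theorem dfn_limitBelow : Dfn M (fun p : PowOmega M × PowOmega M => LimitBelow p.1 p.2) := by
  unfold LimitBelow
  fun_prop

theorem LimitBelow.mono {x y z : PowOmega M} (h : LimitBelow y x) (h' : TuringLE x.1 z.1) :
    LimitBelow y z := by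
  obtain ⟨f, o, ho, hf, h⟩ := h
  obtain ⟨o', u, ho', hu, h'⟩ := h'
  obtain rfl := ho.unique ho'
  exact ⟨f, u, hu, hf.trans h', h⟩

theorem LimitBelow.exists_code {x y : PowOmega M} (h : LimitBelow y x) :
    ∃ e, ∀ n, n ∈ y ↔ ∃ s, ∀ t, s ≤ t → ¬ Ev x e (pair n t) 0 := by
  obtain ⟨f, o, ho, hf, h⟩ := h
  obtain ⟨e, he⟩ := hf.exists_code ho
  simp only [he] at h
  exact ⟨e, h⟩

theorem ComputableIn.limitBelow {x y : PowOmega M} {F : Omega M → Omega M}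
    (hF : ComputableIn x F) (h : ∀ n, n ∈ y ↔ ∃ s, ∀ t, s ≤ t → F (Omega.pair n t) ≠ 0) :
    LimitBelow y x := by
  obtain ⟨o, ho⟩ := exists_isCharFun x
  obtain ⟨f, h1, h2⟩ := exists_partFun_graph hF.dfn
  refine ⟨f, o, ho, hF.isRecursiveIn ho h1 h2, ?_⟩
  simpa only [h2] using h

/-- The characteristic function of y is used as an approximation that does not depend on the stage.
-/
theorem TuringLE.limitBelow {x y : PowOmega M} (h : TuringLE y.1 x.1) : LimitBelow y x := by
  have : LimitBelow y y := by
    refine (ComputableIn.char.comp ComputableIn.left).limitBelow fun n => ?_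
    simp only [left_pair, ne_eq, char_eq_zero, not_not]
    exact ⟨fun h => ⟨0, fun _ _ => h⟩, fun ⟨s, hs⟩ => hs s le_rfl⟩
  exact this.mono h

end Recursive

/-! ### Finite conditions and generic functions -/

section Forcing

variable {M : Type*} [setLang.Structure M] [hM : ModelOfZF M]

open Omega PowOmega

/-- The recursion step for the enumeration of the eventually zero functions. -/
noncomputable def seqStep (c : Omega M) (y : PowOmega M) : PowOmega M :=
  haveI := Classical.dec
  ofFun fun j => if left c = 0 then 0 else
    if j = left (right (right c)) then right (right (right c)) else val (col y (left (right c))) j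

theorem dfn_seqStep : Dfn M (fun p : Omega M × PowOmega M => seqStep p.1 p.2) := by
  unfold seqStep
  fun_prop

/-- The value at `j` of the finitely supported function with code `c`. -/
noncomputable def seq (c j : Omega M) : Omega M := val (col (recSeq seqStep) c) j

@[fun_prop]
theorem dfn_seq : Dfn M (fun p : Omega M × Omega M => seq p.1 p.2) := by
  unfold seq
  fun_prop

open Classical in
theorem seq_update (a l v j : Omega M) :
    seq (pair 1 (pair a (pair l v))) j = if j = l then v else seq a j := by
  have h : pair a (pair l v) < pair 1 (pair a (pair l v)) := right_lt_pair zero_lt_one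
  have h' : col (restrict (recSeq seqStep) (pair 1 (pair a (pair l v)))) a =
      col (recSeq (M := M) seqStep) a := by
    ext n
    simp [mem_restrict, (left_le_pair a _).trans_lt h]
  rw [seq, col_recSeq dfn_seqStep, seqStep, val_ofFun (by fun_prop)]
  simp only [left_pair, right_pair, h', one_ne_zero, if_false]
  rfl

/-- Initial segments are coded by numbers, hence so are conditions. Least-number search over
conditions then replaces choice. -/
theorem exists_seq {f : Omega M → Omega M} (hf : Dfn M f) (l : Omega M) :
    ∃ c, ∀ j, j < l → seq c j = f j := by
  refine induction (P := fun l => ∃ c, ∀ j, j < l → seq c j = f j) (by fun_prop)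
    ⟨0, fun j hj => (not_lt_zero hj).elim⟩ ?_ l
  rintro l ⟨c, hc⟩
  refine ⟨pair 1 (pair c (pair l (f l))), fun j hj => ?_⟩
  rw [seq_update]
  split_ifs with h
  · rw [h]
  · exact hc j (lt_of_le_of_ne (lt_add_one_iff.1 hj) h)

/-- The stem of a condition. -/
noncomputable def stem (p j : Omega M) : Omega M := seq (left p) j

/-- The length of the stem of a condition. -/
noncomputable def len (p : Omega M) : Omega M := left (right p)

/-- The level of the promise of a condition. -/
noncomputable def lvl (p : Omega M) : Omega M := right (right p)

@[fun_prop] theorem dfn_stem : Dfn M (fun p : Omega M × Omega M => stem p.1 p.2) := by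
  unfold stem; fun_prop

@[fun_prop] theorem dfn_len : Dfn M (fun p : Omega M => len p) := by
  unfold len; fun_prop

@[fun_prop] theorem dfn_lvl : Dfn M (fun p : Omega M => lvl p) := by
  unfold lvl; fun_prop

/-- The function coded by `G` satisfies the condition `p`: it extends the stem and keeps the
promise beyond it. -/
def Meets (Pr : Omega M → Omega M → Omega M → Prop) (p : Omega M) (G : PowOmega M) : Prop :=
  (∀ j, j < len p → val G j = stem p j) ∧ ∀ j, len p ≤ j → Pr (lvl p) j (val G j)

/-- The condition `q` extends the condition `p`. -/
def Extends (Pr : Omega M → Omega M → Omega M → Prop) (q p : Omega M) : Prop :=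
  len p ≤ len q ∧ lvl p ≤ lvl q ∧ (∀ j, j < len p → stem q j = stem p j) ∧
    ∀ j, len p ≤ j → j < len q → Pr (lvl p) j (stem q j)

theorem dfn_meets {Pr : Omega M → Omega M → Omega M → Prop}
    (hPr : Dfn M (fun x : Omega M × Omega M × Omega M => Pr x.1 x.2.1 x.2.2)) :
    Dfn M (fun p : Omega M × PowOmega M => Meets Pr p.1 p.2) := by
  unfold Meets
  fun_prop

theorem dfn_extends {Pr : Omega M → Omega M → Omega M → Prop}
    (hPr : Dfn M (fun x : Omega M × Omega M × Omega M => Pr x.1 x.2.1 x.2.2)) :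
    Dfn M (fun p : Omega M × Omega M => Extends Pr p.1 p.2) := by
  unfold Extends
  fun_prop

/-! ### Extension of conditions and construction of generic functions -/

section Conditions

variable {Pr : Omega M → Omega M → Omega M → Prop}

theorem Extends.refl (p : Omega M) : Extends Pr p p :=
  ⟨le_rfl, le_rfl, fun _ _ => rfl, fun _ h h' => (h.not_gt h').elim⟩

theorem Extends.trans (hanti : ∀ k k' j v, k ≤ k' → Pr k' j v → Pr k j v) {p q r : Omega M}
    (h : Extends Pr r q) (h' : Extends Pr q p) : Extends Pr r p := by
  refine ⟨h'.1.trans h.1, h'.2.1.trans h.2.1, fun j hj => ?_, fun j hj hj' => ?_⟩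
  · rw [h.2.2.1 j (hj.trans_le h'.1), h'.2.2.1 j hj]
  · rcases lt_or_ge j (len q) with h1 | h1
    · rw [h.2.2.1 j h1]
      exact h'.2.2.2 j hj h1
    · exact hanti _ _ _ _ h'.2.1 (h.2.2.2 j h1 hj')

theorem exists_condition {f : Omega M → Omega M} (hf : Dfn M f) (l k : Omega M) :
    ∃ q, len q = l ∧ lvl q = k ∧ ∀ j, j < l → stem q j = f j := by
  obtain ⟨c, hc⟩ := exists_seq hf l
  exact ⟨pair c (pair l k), by simp [len], by simp [lvl], by simpa [stem] using hc⟩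

/-- Prolong the stem along G itself and leave the level unchanged: G keeps the old promise but need
not keep a stronger one. -/
theorem Meets.exists_extends {p : Omega M} {G : PowOmega M} (h : Meets Pr p G) {l : Omega M}
    (hl : len p ≤ l) : ∃ q, Extends Pr q p ∧ Meets Pr q G ∧ len q = l := by
  obtain ⟨q, h1, h2, h3⟩ := exists_condition (f := fun j => val G j) (by fun_prop) l (lvl p)
  refine ⟨q, ⟨h1 ▸ hl, h2.ge, fun j hj => ?_, fun j hj hj' => ?_⟩, ⟨fun j hj => ?_, ?_⟩, h1⟩
  · rw [h3 j (hj.trans_le hl), h.1 j hj]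
  · rw [h3 j (h1 ▸ hj')]
    exact h.2 j hj
  · rw [h3 j (h1 ▸ hj)]
  · rw [h1, h2]
    exact fun j hj => h.2 j (hl.trans hj)

/-- A condition can be lengthened by an allowed value. -/
theorem exists_extends_append {p v : Omega M} (hv : Pr (lvl p) (len p) v) :
    ∃ q, Extends Pr q p ∧ len p < len q ∧ lvl p < lvl q ∧ stem q (len p) = v := by
  classical
  obtain ⟨q, h1, h2, h3⟩ := exists_condition
    (f := fun j => if j = len p then v else stem p j) (by fun_prop) (len p + 1) (lvl p + 1)
  have h4 := h3 (len p) (lt_add_one _)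
  rw [if_pos rfl] at h4
  refine ⟨q, ⟨h1 ▸ (lt_add_one _).le, h2 ▸ (lt_add_one _).le, fun j hj => ?_, fun j hj hj' => ?_⟩,
    h1 ▸ lt_add_one _, h2 ▸ lt_add_one _, h4⟩
  · rw [h3 j (hj.trans (lt_add_one _)), if_neg hj.ne]
  · rw [h1, lt_add_one_iff] at hj'
    obtain rfl := le_antisymm hj hj'
    rw [h4]
    exact hv

/-- There is a function which is generic for a given sequence `W` of sets of conditions. -/
theorem exists_generic
    (hPr : Dfn M (fun x : Omega M × Omega M × Omega M => Pr x.1 x.2.1 x.2.2))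
    (hanti : ∀ k k' j v, k ≤ k' → Pr k' j v → Pr k j v) (hex : ∀ k j, ∃ v, Pr k j v)
    {W : Omega M → Omega M → Prop} (hW : Dfn M (fun x : Omega M × Omega M => W x.1 x.2)) :
    ∃ (G : PowOmega M) (r : Omega M → Omega M), (∀ m n, m ≤ n → Extends Pr (r n) (r m)) ∧
      (∀ n, Meets Pr (r n) G) ∧ (∀ n, n ≤ len (r n)) ∧ (∀ n, n ≤ lvl (r n)) ∧
      ∀ n, W n (r (n + 1)) ∨ ∀ q, Extends Pr q (r (n + 1)) → ¬ W n q := by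
  have hE := dfn_extends hPr
  let Good : Omega M → Omega M → Omega M → Prop := fun n p q => Extends Pr q p ∧
    len p < len q ∧ lvl p < lvl q ∧ (W n q ∨ ∀ q', Extends Pr q' q → ¬ W n q')
  have hGood : Dfn M (fun x : Omega M × Omega M × Omega M => Good x.1 x.2.1 x.2.2) := by
    simp only [Good]
    fun_prop
  -- Taking the least good extension makes the successor function definable, so the generic sequence
  -- can be built by recursion in M.
  have h1 : ∀ n p, ∃ q, Good n p q ∧ ∀ q', q' < q → ¬ Good n p q' := by
    intro n p
    refine exists_least (P := fun q => Good n p q) (by fun_prop) ?_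
    obtain ⟨v, hv⟩ := hex (lvl p) (len p)
    obtain ⟨q, hq, hl, hk, -⟩ := exists_extends_append hv
    by_cases h : ∃ q', Extends Pr q' q ∧ W n q'
    · obtain ⟨q', h, h'⟩ := h
      exact ⟨q', h.trans hanti hq, hl.trans_le h.1, hk.trans_le h.2.1, Or.inl h'⟩
    · push Not at h
      exact ⟨q, hq, hl, hk, Or.inr h⟩
  choose S hS hS' using h1
  have hSd : Dfn M (fun x : Omega M × Omega M => S x.1 x.2) := by
    refine Dfn.of_graph ?_
    have : (fun x : (Omega M × Omega M) × Omega M => S x.1.1 x.1.2 = x.2) =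
        fun x => Good x.1.1 x.1.2 x.2 ∧ ∀ q, q < x.2 → ¬ Good x.1.1 x.1.2 q := by
      funext x
      refine propext ⟨fun h => h ▸ ⟨hS _ _, hS' _ _⟩, fun ⟨h, h'⟩ => ?_⟩
      exact le_antisymm (not_lt.1 fun h2 => hS' _ _ _ h2 h) (not_lt.1 fun h2 => h' _ h2 (hS _ _))
    rw [this]
    fun_prop
  obtain ⟨r, hr, -, hrs⟩ := exists_fun_recursion 0 hSd
  have h2 : ∀ n, Good n (r n) (r (n + 1)) := fun n => hrs n ▸ hS n (r n)
  have hext : ∀ m n, m ≤ n → Extends Pr (r n) (r m) := by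
    intro m
    refine induction (by fun_prop) (fun h => ?_) fun n ih h => ?_
    · rw [nonpos_iff_eq_zero.1 h]
      exact Extends.refl _
    · rcases h.lt_or_eq with h | rfl
      · exact (h2 n).1.trans hanti (ih (lt_add_one_iff.1 h))
      · exact Extends.refl _
  have hlen : ∀ n, n ≤ len (r n) := by
    refine induction (by fun_prop) zero_le fun n ih => ?_
    exact add_one_le_iff.2 (ih.trans_lt (h2 n).2.1)
  have hlvl : ∀ n, n ≤ lvl (r n) := by
    refine induction (by fun_prop) zero_le fun n ih => ?_
    exact add_one_le_iff.2 (ih.trans_lt (h2 n).2.2.1)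
  have hG : ∀ j, val (ofFun fun j => stem (r (j + 1)) j) j = stem (r (j + 1)) j :=
    fun j => val_ofFun (by fun_prop) j
  have hj : ∀ j, j < len (r (j + 1)) := fun j => add_one_le_iff.1 (hlen (j + 1))
  -- The stem of r (j + 1) has length at least j + 1, so it has already fixed the value at j.
  refine ⟨ofFun fun j => stem (r (j + 1)) j, r, hext, fun n => ⟨fun j h => ?_, fun j h => ?_⟩,
    hlen, hlvl, fun n => (h2 n).2.2.2⟩
  · rw [hG]
    rcases le_total n (j + 1) with h3 | h3
    · exact (hext _ _ h3).2.2.1 j h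
    · exact ((hext _ _ h3).2.2.1 j (hj j)).symm
  · rw [hG]
    exact (hext n (j + 1) (((hlen n).trans h).trans (lt_add_one j).le)).2.2.2 j h (hj j)

end Conditions

/-! ### Coding a sequence of reals along a function -/

/-- The real whose `j`-th column consists of one bit given by the first component of `G j`,
followed by the column of `g` whose index is the second component of `G j`. -/
noncomputable def interleave (g G : PowOmega M) : PowOmega M :=
  mk fun m => (right m = 0 ∧ left (val G (left m)) = 0) ∨
    ∃ n, right m = n + 1 ∧ n ∈ col g (right (val G (left m)))

@[fun_prop]
theorem dfn_interleave :
    Dfn M (fun p : PowOmega M × PowOmega M => interleave p.1 p.2) := by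
  unfold interleave
  fun_prop

theorem mem_interleave {g G : PowOmega M} {m : Omega M} : m ∈ interleave g G ↔
    (right m = 0 ∧ left (val G (left m)) = 0) ∨
      ∃ n, right m = n + 1 ∧ n ∈ col g (right (val G (left m))) :=
  mem_mk (by fun_prop)

theorem pair_zero_mem_interleave {g G : PowOmega M} {j : Omega M} :
    pair j 0 ∈ interleave g G ↔ left (val G j) = 0 := by
  rw [mem_interleave]
  simp [(add_one_ne_zero _).symm]

theorem pair_add_one_mem_interleave {g G : PowOmega M} {j n : Omega M} :
    pair j (n + 1) ∈ interleave g G ↔ n ∈ col g (right (val G j)) := by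
  rw [mem_interleave]
  simp

theorem col_turingLE_interleave (g G : PowOmega M) (j : Omega M) :
    TuringLE (col g (right (val G j))).1 (interleave g G).1 := by
  have h : ComputableIn (interleave g G) fun n => char (interleave g G) (pair j (n + 1)) :=
    ComputableIn.char.comp ((ComputableIn.const j).pair ComputableIn.add_one)
  have e : char (col g (right (val G j))) = fun n => char (interleave g G) (pair j (n + 1)) := by
    funext n
    exact char_congr pair_add_one_mem_interleave.symm
  exact ComputableIn.turingLE (e ▸ h)

/-- Whether m belongs to the real depends on G only at left m, and left m ≤ m. -/
theorem agree_interleave {g G G' : PowOmega M} {s : Omega M}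
    (h : ∀ j, j < s → val G' j = val G j) : Agree (interleave g G) (interleave g G') s := by
  intro m hm
  have hl : left m < s := by
    refine lt_of_le_of_lt ?_ hm
    conv_rhs => rw [← pair_left_right m]
    exact left_le_pair _ _
  rw [mem_interleave, mem_interleave, h _ hl]

/-- Continuity plays the role of the forcing theorem: a computation uses finitely much of G, so a
longer stem guarantees it for all functions meeting the condition, generic or not. -/
theorem Meets.exists_forces {Pr : Omega M → Omega M → Omega M → Prop} {p : Omega M}
    {g G : PowOmega M} (h : Meets Pr p G) {e n v : Omega M} (hv : Ev (interleave g G) e n v) :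
    ∃ q, Extends Pr q p ∧ ∀ G', Meets Pr q G' → Ev (interleave g G') e n v := by
  obtain ⟨s, hs⟩ := ev_continuous hv
  obtain ⟨q, h1, h2, h3⟩ := h.exists_extends (le_max_right s (len p))
  refine ⟨q, h1, fun G' hG' => hs _ (agree_interleave fun j hj => ?_)⟩
  have : j < len q := h3 ▸ hj.trans_le (le_max_left _ _)
  rw [hG'.1 j this, h2.1 j this]

/-- The set decided by a condition below which the program `e` computes, in the limit, a
member of the ground sequence `g`. -/
noncomputable def forcedLimit (g : PowOmega M) (e p : Omega M) : PowOmega M :=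
  mk fun n => ∃ q, Extends (fun _ _ _ => True) q p ∧ ∃ s, ∀ G, Meets (fun _ _ _ => True) q G →
    ∀ t, s ≤ t → ¬ Ev (interleave g G) e (pair n t) 0

theorem dfn_forcedLimit : Dfn M (fun x : PowOmega M × Omega M × Omega M =>
    forcedLimit x.1 x.2.1 x.2.2) := by
  have h1 := dfn_meets (M := M) (Pr := fun _ _ _ => True) (by fun_prop)
  have h2 := dfn_extends (M := M) (Pr := fun _ _ _ => True) (by fun_prop)
  unfold forcedLimit
  fun_prop

theorem mem_forcedLimit {g : PowOmega M} {e p n : Omega M} : n ∈ forcedLimit g e p ↔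
    ∃ q, Extends (fun _ _ _ => True) q p ∧ ∃ s, ∀ G, Meets (fun _ _ _ => True) q G →
      ∀ t, s ≤ t → ¬ Ev (interleave g G) e (pair n t) 0 := by
  have h1 := dfn_meets (M := M) (Pr := fun _ _ _ => True) (by fun_prop)
  have h2 := dfn_extends (M := M) (Pr := fun _ _ _ => True) (by fun_prop)
  exact mem_mk (by fun_prop)

/-- An upper bound of the columns of `g` in which a given real is not a limit. -/
theorem exists_bound_not_limitBelow {g y : PowOmega M} (hy : ∀ e p, y ≠ forcedLimit g e p) :
    ∃ x : PowOmega M, (∀ i, TuringLE (col g i).1 x.1) ∧ ¬ LimitBelow y x := by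
  let Pr : Omega M → Omega M → Omega M → Prop := fun _ _ _ => True
  have h1 : Dfn M (fun p : Omega M × PowOmega M => Meets Pr p.1 p.2) := dfn_meets (by fun_prop)
  -- Tag 0: program e is forced to put some n ∉ y into its limit. Tag 1: program e is forced to
  -- output 0 on n at some stage beyond s. Tag 2: a given column of g has been coded.
  let W : Omega M → Omega M → Prop := fun t q =>
    (left t = 0 ∧ ∃ n, ¬ n ∈ y ∧ ∃ s, ∀ G, Meets Pr q G → ∀ t', s ≤ t' →
      ¬ Ev (interleave g G) (right t) (pair n t') 0) ∨
    (left t = 1 ∧ ∃ t', right (right (right t)) ≤ t' ∧ ∀ G, Meets Pr q G →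
      Ev (interleave g G) (left (right t)) (pair (left (right (right t))) t') 0) ∨
    (left t = 2 ∧ ∃ j, j < len q ∧ right (stem q j) = right t)
  have hWd : Dfn M (fun x : Omega M × Omega M => W x.1 x.2) := by
    simp only [W]
    fun_prop
  have hanti : ∀ k k' j v : Omega M, k ≤ k' → Pr k' j v → Pr k j v := fun _ _ _ _ _ h => h
  obtain ⟨G, r, hr, hG, -, -, hW⟩ := exists_generic (Pr := Pr) (by fun_prop) hanti
    (fun _ _ => ⟨0, trivial⟩) hWd
  refine ⟨interleave g G, fun i => ?_, fun hlim => ?_⟩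
  · have h2 : ∃ j, right (val G j) = i := by
      rcases hW (pair 2 i) with h | h
      · simp only [W, left_pair, right_pair, OfNat.ofNat_ne_zero, OfNat.ofNat_ne_one, false_and,
          true_and, false_or] at h
        obtain ⟨j, hj, h⟩ := h
        exact ⟨j, by rw [(hG _).1 j hj, h]⟩
      · obtain ⟨q, h2, h3, -, h4⟩ := exists_extends_append (Pr := Pr) (p := r (pair 2 i + 1))
          (v := pair 0 i) trivial
        exact (h q h2 (Or.inr (Or.inr ⟨left_pair _ _, _, h3, by rw [h4, right_pair, right_pair]⟩))).elim
    obtain ⟨j, rfl⟩ := h2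
    exact col_turingLE_interleave g G j
  · obtain ⟨e, he⟩ := hlim.exists_code
    refine hy e (r (pair 0 e + 1)) ?_
    have h2 : ∀ q, Extends Pr q (r (pair 0 e + 1)) → ¬ W (pair 0 e) q := by
      refine (hW (pair 0 e)).resolve_left fun h => ?_
      simp only [W, left_pair, right_pair, OfNat.zero_ne_ofNat, zero_ne_one, false_and,
        true_and, or_false] at h
      obtain ⟨n, hn, s, hs⟩ := h
      exact hn ((he n).2 ⟨s, hs G (hG _)⟩)
    ext n
    rw [mem_forcedLimit]
    constructor
    · intro hn
      obtain ⟨s, hs⟩ := (he n).1 hn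
      set t := pair 1 (pair e (pair n s)) with ht
      have h3 : ∀ q, Extends Pr q (r (t + 1)) → ¬ W t q := by
        refine (hW t).resolve_left fun h => ?_
        simp only [W, ht, left_pair, right_pair, OfNat.one_ne_ofNat, one_ne_zero, false_and,
          true_and, or_false, false_or] at h
        obtain ⟨t', h4, h5⟩ := h
        exact hs t' h4 (h5 G (hG _))
      -- This condition extends both the one defining `forcedLimit` and the one below which output 0
      -- on n beyond s cannot be forced. An output 0 for any G' meeting it would yield an extension
      -- that forces it.
      refine ⟨r (max (pair 0 e + 1) (t + 1)), hr _ _ (le_max_left _ _), s, fun G' hG' t' ht' h => ?_⟩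
      obtain ⟨q, h4, h5⟩ := hG'.exists_forces h
      refine h3 q (h4.trans hanti (hr _ _ (le_max_right _ _))) (Or.inr (Or.inl ?_))
      simp only [ht, left_pair, right_pair, true_and]
      exact ⟨t', ht', h5⟩
    · rintro ⟨q, h3, s, hs⟩
      by_contra hn
      refine h2 q h3 (Or.inl ⟨left_pair _ _, n, hn, s, ?_⟩)
      rw [right_pair]
      exact hs

/-- The set decided by a condition below which the program `e` computes a member of the ground
sequence `g`; the promise of the condition is given by the code `u`. -/
noncomputable def forcedValue (g : PowOmega M) (e p u : Omega M) : PowOmega M :=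
  mk fun n => ∃ G : PowOmega M, Meets (fun k j v => left j < k → (left v = 0 ↔ seq u (left j) = 0))
    p G ∧ Ev (interleave g G) e n 1

theorem dfn_forcedValue : Dfn M (fun x : PowOmega M × Omega M × Omega M × Omega M =>
    forcedValue x.1 x.2.1 x.2.2.1 x.2.2.2) := by
  unfold forcedValue Meets
  fun_prop

theorem mem_forcedValue {g : PowOmega M} {e p u n : Omega M} : n ∈ forcedValue g e p u ↔
    ∃ G : PowOmega M, Meets (fun k j v => left j < k → (left v = 0 ↔ seq u (left j) = 0)) p G ∧
      Ev (interleave g G) e n 1 := by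
  have h1 := dfn_meets (Pr := fun k j v => left j < k → (left v = 0 ↔ seq u (left j) = 0))
    (by fun_prop)
  exact mem_mk (by fun_prop)

/-- An upper bound of the columns of `g` which does not compute a given real, in which all
columns of `w` are limits. -/
theorem exists_bound_limitBelow {g y : PowOmega M} (hy : ∀ e p u, y ≠ forcedValue g e p u)
    (w : PowOmega M) :
    ∃ x : PowOmega M, (∀ i, TuringLE (col g i).1 x.1) ∧ ¬ TuringLE y.1 x.1 ∧
      ∀ i, LimitBelow (col w i) x := by
  -- Position j = ⟨i, t⟩ carries the t-th guess at bit i of w, and a condition of level k promises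
  -- that guesses beyond its stem are right for all i < k. The second component of v is left free
  -- for coding columns of g.
  let Pr : Omega M → Omega M → Omega M → Prop := fun k j v => left j < k → (left v = 0 ↔ left j ∈ w)
  have hPr : Dfn M (fun x : Omega M × Omega M × Omega M => Pr x.1 x.2.1 x.2.2) := by
    simp only [Pr]
    fun_prop
  have h1 : Dfn M (fun p : Omega M × PowOmega M => Meets Pr p.1 p.2) := dfn_meets hPr
  let W : Omega M → Omega M → Prop := fun t q =>
    (left t = 0 ∧ ∃ n, ¬ n ∈ y ∧ ∀ G, Meets Pr q G → Ev (interleave g G) (right t) n 1) ∨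
    (left t = 2 ∧ ∃ j, j < len q ∧ right (stem q j) = right t)
  have hWd : Dfn M (fun x : Omega M × Omega M => W x.1 x.2) := by
    simp only [W]
    fun_prop
  have hanti : ∀ k k' j v : Omega M, k ≤ k' → Pr k' j v → Pr k j v :=
    fun _ _ _ _ h h' h2 => h' (h2.trans_le h)
  have hex : ∀ k j i, ∃ v, Pr k j v ∧ right v = i := by
    intro k j i
    by_cases h : left j ∈ w
    · exact ⟨pair 0 i, fun _ => iff_of_true (left_pair _ _) h, right_pair _ _⟩
    · exact ⟨pair 1 i, fun _ => iff_of_false (by simp) h, right_pair _ _⟩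
  obtain ⟨G, r, hr, hG, hlen, hlvl, hW⟩ := exists_generic hPr hanti
    (fun k j => (hex k j 0).imp fun _ h => h.1) hWd
  refine ⟨interleave g G, fun i => ?_, fun hle => ?_, fun i => ?_⟩
  · have h2 : ∃ j, right (val G j) = i := by
      rcases hW (pair 2 i) with h | h
      · simp only [W, left_pair, right_pair, OfNat.ofNat_ne_zero, false_and,
          true_and, false_or] at h
        obtain ⟨j, hj, h⟩ := h
        exact ⟨j, by rw [(hG _).1 j hj, h]⟩
      · obtain ⟨v, hv, hvi⟩ := hex (lvl (r (pair 2 i + 1))) (len (r (pair 2 i + 1))) i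
        obtain ⟨q, h2, h3, -, h4⟩ := exists_extends_append hv
        exact (h q h2 (Or.inr ⟨left_pair _ _, _, h3, by rw [h4, hvi, right_pair]⟩)).elim
    obtain ⟨j, rfl⟩ := h2
    exact col_turingLE_interleave g G j
  · obtain ⟨e, he⟩ := hle.exists_code
    set p := r (pair 0 e + 1)
    have h2 : ∀ q, Extends Pr q p → ¬ W (pair 0 e) q := by
      refine (hW (pair 0 e)).resolve_left fun h => ?_
      simp only [W, left_pair, right_pair, OfNat.zero_ne_ofNat, false_and, true_and,
        or_false] at h
      obtain ⟨n, hn, h⟩ := h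
      exact hn ((he n).2 (h G (hG _)))
    classical
    -- The promise of p concerns only the bits of w below its level. Coding them by u removes w from
    -- the description, so y would be one of the sets determined by g and numbers alone.
    obtain ⟨u, hu⟩ := exists_seq (f := fun i => if i ∈ w then 0 else 1) (by fun_prop) (lvl p)
    have h3 : ∀ G', Meets Pr p G' ↔
        Meets (fun k j v => left j < k → (left v = 0 ↔ seq u (left j) = 0)) p G' := by
      intro G'
      refine and_congr_right fun _ => forall₂_congr fun j _ => imp_congr_right fun h => ?_
      rw [hu _ h]
      by_cases hj : left j ∈ w <;> simp [hj]
    refine hy e p u ?_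
    ext n
    simp only [mem_forcedValue, ← h3]
    constructor
    · exact fun hn => ⟨G, hG _, (he n).1 hn⟩
    · rintro ⟨G', hG', h⟩
      by_contra hn
      obtain ⟨q, h4, h5⟩ := hG'.exists_forces h
      refine h2 q h4 (Or.inl ⟨left_pair _ _, n, hn, ?_⟩)
      rw [right_pair]
      exact h5
  · have hF : ComputableIn (interleave g G) fun m =>
        char (interleave g G) (pair (pair (pair i (left m)) (right m)) 0) :=
      ComputableIn.char.comp ((((ComputableIn.const i).pair ComputableIn.left).pair
        ComputableIn.right).pair (ComputableIn.const 0))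
    refine hF.limitBelow fun n => ?_
    simp only [left_pair, right_pair, ne_eq, char_eq_zero, not_not, pair_zero_mem_interleave,
      mem_col]
    set k := pair i n
    -- The condition r (k + 1) has level above k, so from its length on every guess at bit k is
    -- right.
    have h2 : ∀ t, len (r (k + 1)) ≤ t → (left (val G (pair k t)) = 0 ↔ k ∈ w) := by
      intro t ht
      have h3 := (hG (k + 1)).2 (pair k t) (ht.trans (right_le_pair _ _))
      simp only [Pr, left_pair] at h3
      exact h3 (add_one_le_iff.1 (hlvl (k + 1)))
    refine ⟨fun hn => ⟨_, fun t ht => (h2 t ht).2 hn⟩, fun ⟨s, hs⟩ => ?_⟩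
    exact (h2 _ (le_max_right s _)).1 (hs _ (le_max_left _ _))

end Forcing

/-! ### Countable families and Turing determinacy -/

section Countable

variable {M : Type*} [setLang.Structure M] [hM : ModelOfZF M]

open Omega PowOmega

/-- Column i is the element sent to i by the injection, and is empty if there is none. Empty columns
are harmless, since an enumeration may list extra reals. -/
theorem IsCountable.exists_enumeration {A : M} (h : IsCountable A) :
    ∃ e : PowOmega M, ∀ x : PowOmega M, x.1 ∈ₘ A → ∃ i, col e i = x := by
  obtain ⟨f, ⟨h1, h2⟩, hinj⟩ := h
  let e : PowOmega M := mk fun p => ∃ x : PowOmega M, x.1 ∈ₘ A ∧ App f x.1 (left p).1 ∧ right p ∈ x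
  have he : ∀ p, p ∈ e ↔ ∃ x : PowOmega M, x.1 ∈ₘ A ∧ App f x.1 (left p).1 ∧ right p ∈ x :=
    fun p => mem_mk (by fun_prop)
  refine ⟨e, fun x hx => ?_⟩
  obtain ⟨b, ⟨p, hp, hpf⟩, -⟩ := h2 x.1 hx
  obtain ⟨a', b', -, hb, hp'⟩ := h1 p hpf
  obtain ⟨-, rfl⟩ := hp.inj hp'
  obtain ⟨i, rfl⟩ : ∃ i : Omega M, i.1 = b := ⟨⟨b, hb⟩, rfl⟩
  refine ⟨i, ?_⟩
  ext n
  rw [mem_col, he, left_pair, right_pair]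
  constructor
  · rintro ⟨y, -, hy, hn⟩
    rwa [← Subtype.ext (hinj _ _ _ hy ⟨p, hp, hpf⟩)]
  · exact fun hn => ⟨x, hx, ⟨p, hp, hpf⟩, hn⟩

/-- Each element is sent to its least index. -/
theorem isCountable_of_enumeration {A : M} (hA : ∀ x, x ∈ₘ A → IsReal x) {e : PowOmega M}
    (he : ∀ x : PowOmega M, x.1 ∈ₘ A → ∃ i, col e i = x) : IsCountable A := by
  obtain ⟨w, hw⟩ := exists_omega M
  obtain ⟨f, h1, h2⟩ := exists_graph (M := M) (φ := fun x n => ∃ (y : PowOmega M) (i : Omega M),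
    y.1 = x ∧ i.1 = n ∧ col e i = y ∧ ∀ j, j < i → col e j ≠ y) (by fun_prop) A w
  refine ⟨f, ⟨fun p hp => ?_, fun x hx => ?_⟩, fun a a' n h h' => ?_⟩
  · obtain ⟨a, b, ha, hb, h⟩ := h1 p hp
    exact ⟨a, b, ha, (hw b).1 hb, h⟩
  · obtain ⟨y, rfl⟩ : ∃ y : PowOmega M, y.1 = x := ⟨⟨x, hA x hx⟩, rfl⟩
    obtain ⟨i, hi, hi'⟩ := exists_least (P := fun i => col e i = y) (by fun_prop) (he y hx)
    refine ⟨i.1, (h2 _ _).2 ⟨hx, (hw _).2 i.2, y, i, rfl, rfl, hi, hi'⟩, ?_⟩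
    intro n hn
    obtain ⟨-, -, y', j, h3, rfl, hj, hj'⟩ := (h2 _ _).1 hn
    obtain rfl : y' = y := Subtype.ext h3
    have hji : j = i :=
      le_antisymm (not_lt.1 fun h => hj' _ h hi) (not_lt.1 fun h => hi' _ h hj)
    rw [hji]
  · obtain ⟨-, -, y, j, rfl, rfl, hj, -⟩ := (h2 _ _).1 h
    obtain ⟨-, -, y', j', rfl, h3, hj', -⟩ := (h2 _ _).1 h'
    rw [← hj, ← hj', Subtype.ext h3]

/-- All sets decided by conditions for the ground sequence `g`. -/
noncomputable def forced (g : PowOmega M) (c : Omega M) : PowOmega M :=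
  if left c = 0 then forcedLimit g (left (right c)) (right (right c))
  else forcedValue g (left (right c)) (left (right (right c))) (right (right (right c)))

@[fun_prop]
theorem dfn_forced : Dfn M (fun p : PowOmega M × Omega M => forced p.1 p.2) := by
  have h1 := dfn_forcedLimit (M := M)
  have h2 := dfn_forcedValue (M := M)
  unfold forced
  exact Dfn.ite (by fun_prop)
    (h1.comp (f := fun p : PowOmega M × Omega M =>
      (p.1, left (right p.2), right (right p.2))) (by fun_prop))
    (h2.comp (f := fun p : PowOmega M × Omega M =>
      (p.1, left (right p.2), left (right (right p.2)), right (right (right p.2)))) (by fun_prop))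

theorem forced_limit (g : PowOmega M) (e p : Omega M) :
    forced g (pair 0 (pair e p)) = forcedLimit g e p := by
  simp [forced]

theorem forced_value (g : PowOmega M) (e p u : Omega M) :
    forced g (pair 1 (pair e (pair p u))) = forcedValue g e p u := by
  simp [forced]

/-- The columns of `g` together with all sets decided by conditions. -/
noncomputable def extend (g : PowOmega M) : PowOmega M :=
  mk fun p => (left (left p) = 0 ∧ right p ∈ col g (right (left p))) ∨
    (¬ left (left p) = 0 ∧ right p ∈ forced g (right (left p)))

@[fun_prop]
theorem dfn_extend : Dfn M (fun g : PowOmega M => extend g) := by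
  unfold extend
  fun_prop

theorem mem_extend {g : PowOmega M} {p : Omega M} : p ∈ extend g ↔
    (left (left p) = 0 ∧ right p ∈ col g (right (left p))) ∨
      (¬ left (left p) = 0 ∧ right p ∈ forced g (right (left p))) :=
  mem_mk (by fun_prop)

theorem col_extend_zero (g : PowOmega M) (i : Omega M) : col (extend g) (pair 0 i) = col g i := by
  ext n
  rw [mem_col, mem_extend]
  simp

theorem col_extend_one (g : PowOmega M) (c : Omega M) :
    col (extend g) (pair 1 c) = forced g c := by
  ext n
  rw [mem_col, mem_extend]
  simp

/-- The iteration of `extend` starting with a real `z`. -/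
theorem exists_extend_sequence (z : PowOmega M) : ∃ s : PowOmega M,
    (∀ i, col (col s 0) i = z) ∧ ∀ m, col s (m + 1) = extend (col s m) := by
  let K : Omega M → PowOmega M → PowOmega M := fun c y => mk fun n =>
    (c = 0 ∧ right n ∈ z) ∨ ∃ m, c = m + 1 ∧ n ∈ extend (col y m)
  have hK : Dfn M (fun x : Omega M × PowOmega M => K x.1 x.2) := by
    simp only [K]
    fun_prop
  have hmem : ∀ c y n, n ∈ K c y ↔
      (c = 0 ∧ right n ∈ z) ∨ ∃ m, c = m + 1 ∧ n ∈ extend (col y m) :=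
    fun c y n => mem_mk (by fun_prop)
  refine ⟨recSeq K, fun i => ?_, fun m => ?_⟩
  · ext n
    rw [col_recSeq hK, mem_col, hmem]
    simp [(add_one_ne_zero _).symm]
  · ext n
    rw [col_recSeq hK, hmem]
    have : col (restrict (recSeq K) (m + 1)) m = col (recSeq K) m := by
      ext k
      simp [mem_restrict]
    simp [this]

theorem exists_degree (x : PowOmega M) : ∃ d, IsDegree d ∧
    ∀ y : PowOmega M, y.1 ∈ₘ d ↔ TuringLE y.1 x.1 ∧ TuringLE x.1 y.1 := by
  obtain ⟨p, hp⟩ := exists_powOmega M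
  obtain ⟨d, hd⟩ := separation (M := M) (P := fun y => TuringLE y x.1 ∧ TuringLE x.1 y)
    (by fun_prop) p
  refine ⟨d, ⟨x.1, x.2, fun y => (hd y).trans (and_congr (hp y) Iff.rfl)⟩, fun y => ?_⟩
  rw [hd, hp]
  simp [y.2]

@[fun_prop]
theorem dfn_isDegree : Dfn M (fun d : M => IsDegree d) := by
  unfold IsDegree
  fun_prop

/-- Turing determinacy for definable predicates on reals invariant under Turing equivalence. -/
theorem TuringDeterminacy.exists_cone (hTD : TuringDeterminacy M) {P : PowOmega M → Prop}
    (hP : Dfn M P)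
    (hinv : ∀ x y : PowOmega M, TuringLE x.1 y.1 → TuringLE y.1 x.1 → P x → P y) :
    ∃ z : PowOmega M, (∀ x : PowOmega M, TuringLE z.1 x.1 → P x) ∨
      ∀ x : PowOmega M, TuringLE z.1 x.1 → ¬ P x := by
  obtain ⟨p, hp⟩ := exists_powOmega M
  obtain ⟨q, hq⟩ := hM.out.powerset p
  -- TD speaks about sets of degrees, and degrees are subsets of the set of reals. By invariance one
  -- representative with P is as good as all.
  obtain ⟨A, hA⟩ := separation (M := M) (P := fun d => IsDegree d ∧ ∃ x : PowOmega M, x.1 ∈ₘ d ∧ P x)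
    (by fun_prop) q
  have hA' : ∀ x : PowOmega M, ∀ d, IsDegree d →
      (∀ y : PowOmega M, y.1 ∈ₘ d ↔ TuringLE y.1 x.1 ∧ TuringLE x.1 y.1) → (d ∈ₘ A ↔ P x) := by
    intro x d hd hdx
    rw [hA]
    constructor
    · rintro ⟨-, -, y, hy, h⟩
      exact hinv y x ((hdx y).1 hy).1 ((hdx y).1 hy).2 h
    · intro h
      refine ⟨(hq d).2 fun y hy => (hp y).2 ?_, hd, x, (hdx x).2 ⟨turingLE_refl x, turingLE_refl x⟩, h⟩
      obtain ⟨x', -, hx'⟩ := hd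
      exact ((hx' y).1 hy).1
  have hrep : ∀ d, IsDegree d → ∃ z : PowOmega M, z.1 ∈ₘ d := by
    rintro d ⟨x, hx, h⟩
    exact ⟨⟨x, hx⟩, (h x).2 ⟨hx, turingLE_refl ⟨x, hx⟩, turingLE_refl ⟨x, hx⟩⟩⟩
  rcases hTD A fun d hd => ((hA d).1 hd).2.1 with ⟨d, hd, h⟩ | ⟨d, hd, h⟩ <;>
    obtain ⟨z, hz⟩ := hrep d hd
  · refine ⟨z, Or.inl fun x hx => ?_⟩
    obtain ⟨e, he, hex⟩ := exists_degree x
    exact (hA' x e he hex).1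
      (h e he ⟨z.1, x.1, hz, (hex x).2 ⟨turingLE_refl x, turingLE_refl x⟩, hx⟩)
  · refine ⟨z, Or.inr fun x hx h' => ?_⟩
    obtain ⟨e, he, hex⟩ := exists_degree x
    exact h e he ⟨z.1, x.1, hz, (hex x).2 ⟨turingLE_refl x, turingLE_refl x⟩, hx⟩
      ((hA' x e he hex).2 h')

/-- Under Turing determinacy, the union of a definable sequence of countable sets of reals is
countable. -/
theorem TuringDeterminacy.exists_enumeration_union (hTD : TuringDeterminacy M)
    {A : Omega M → PowOmega M → Prop} (hA : Dfn M (fun p : Omega M × PowOmega M => A p.1 p.2))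
    (hcount : ∀ n, ∃ e, ∀ x, A n x → ∃ i, col e i = x) :
    ∃ e, ∀ n x, A n x → ∃ i, col e i = x := by
  by_contra hcon
  let P : PowOmega M → Prop := fun x => ∃ m, (∀ k, k < m → ∀ y, A k y → TuringLE y.1 x.1) ∧
    (∃ y, A m y ∧ ¬ TuringLE y.1 x.1) ∧ ∀ y, A m y → LimitBelow y x
  have hP : Dfn M P := by
    simp only [P]
    fun_prop
  obtain ⟨z, hz⟩ := hTD.exists_cone hP (by
    rintro x y hxy hyx ⟨m, h1, ⟨u, h2, h3⟩, h4⟩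
    exact ⟨m, fun k hk v hv => turingLE_trans (h1 k hk v hv) hxy,
      ⟨u, h2, fun h => h3 (turingLE_trans h hyx)⟩, fun v hv => (h4 v hv).mono hxy⟩)
  obtain ⟨s, hs0, hs⟩ := exists_extend_sequence z
  have hmono : ∀ m k i, ∃ j, col (col s (k + m)) j = col (col s k) i := by
    refine induction (by fun_prop) (fun k i => ⟨i, by rw [add_zero]⟩) fun m ih k i => ?_
    obtain ⟨j, hj⟩ := ih k i
    exact ⟨pair 0 j, by rw [← add_assoc, hs, col_extend_zero, hj]⟩
  -- If not, every member of every A_m is a column of stage m + 1, and reindexing the columns of s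
  -- gives an enumeration of the union.
  have hex : ∃ m, ∃ y, A m y ∧ ∀ c, y ≠ forced (col s m) c := by
    by_contra! h
    let e : PowOmega M := mk fun p =>
      pair (left (left p)) (pair (right (left p)) (right p)) ∈ s
    have he : ∀ m i, col e (pair m i) = col (col s m) i := by
      intro m i
      ext n
      rw [mem_col, mem_mk (by fun_prop)]
      simp
    refine hcon ⟨e, fun n x hx => ?_⟩
    obtain ⟨c, rfl⟩ := h n x hx
    exact ⟨pair (n + 1) (pair 1 c), by rw [he, hs, col_extend_one]⟩
  obtain ⟨m, ⟨y, hy, hyc⟩, hm⟩ := exists_least (by fun_prop) hex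
  push Not at hm
  have hz' : ∃ i, col (col s m) i = z := by
    obtain ⟨j, hj⟩ := hmono m 0 0
    exact ⟨j, by rw [zero_add, hs0] at hj; exact hj⟩
  -- By minimality of m, A_k is covered by the sets forced over stage k, which are columns of stage
  -- k + 1 ≤ m.
  have hlow : ∀ k, k < m → ∀ x, A k x → ∃ i, col (col s m) i = x := by
    intro k hk x hx
    obtain ⟨c, rfl⟩ := hm k hk x hx
    obtain ⟨d, rfl⟩ := Omega.le_def.1 (add_one_le_iff.2 hk)
    obtain ⟨j, hj⟩ := hmono d (k + 1) (pair 1 c)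
    exact ⟨j, by rw [hj, hs, col_extend_one]⟩
  -- An enumeration is needed for this single m only, so no countable choice enters.
  obtain ⟨w, hw⟩ := hcount m
  obtain ⟨x₁, h1, h2⟩ := exists_bound_not_limitBelow
    (fun e p => forced_limit (col s m) e p ▸ hyc _)
  obtain ⟨x₂, h3, h4, h5⟩ := exists_bound_limitBelow
    (fun e p u => forced_value (col s m) e p u ▸ hyc _) w
  have hbelow : ∀ x : PowOmega M, (∀ i, TuringLE (col (col s m) i).1 x.1) →
      TuringLE z.1 x.1 ∧ ∀ k, k < m → ∀ y, A k y → TuringLE y.1 x.1 := by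
    intro x hx
    refine ⟨?_, fun k hk y hy => ?_⟩
    · obtain ⟨i, rfl⟩ := hz'
      exact hx i
    · obtain ⟨i, rfl⟩ := hlow k hk y hy
      exact hx i
  have hP₁ : ¬ P x₁ := by
    rintro ⟨k, h6, ⟨v, h7, h8⟩, h9⟩
    rcases lt_trichotomy k m with h | rfl | h
    · exact h8 ((hbelow x₁ h1).2 k h v h7)
    · exact h2 (h9 y hy)
    · exact h2 (h6 m h y hy).limitBelow
  have hP₂ : P x₂ := by
    refine ⟨m, (hbelow x₂ h3).2, ⟨y, hy, h4⟩, fun v hv => ?_⟩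
    obtain ⟨i, rfl⟩ := hw v hv
    exact h5 i
  rcases hz with hz | hz
  · exact hP₁ (hz x₁ (hbelow x₁ h1).1)
  · exact hz x₂ (hbelow x₂ h3).1 hP₂

end Countable

end SetModel

/-- ZF + TD proves that a countable union of countable sets of reals is countable: this holds in
every model of ZF + TD. -/
theorem mainTheorem2 (M : Type*) [setLang.Structure M]
    (hZF : SetModel.IsModelOfZF M) (hTD : SetModel.TuringDeterminacy M) :
    SetModel.CountableUnionOfCountableSetsOfReals M := by
  open SetModel in
  have : ModelOfZF M := ⟨hZF⟩
  intro w F hw hF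
  obtain ⟨p, hp⟩ := PowOmega.exists_powOmega M
  obtain ⟨U, hU⟩ := separation (M := M) (P := fun x => ∃ n A, App F n A ∧ x ∈ₘ A) (by fun_prop) p
  have hmem : ∀ n A, App F n A →
      IsNat n ∧ (∀ x, x ∈ₘ A → IsReal x) ∧ IsCountable A := by
    rintro n A ⟨q, hq, hqF⟩
    obtain ⟨n', A', hn, hA, hq'⟩ := hF.1 q hqF
    obtain ⟨rfl, rfl⟩ := hq.inj hq'
    exact ⟨(hw n).1 hn, hA⟩
  have hU' : ∀ x, x ∈ₘ U ↔ ∃ n A, App F n A ∧ x ∈ₘ A := by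
    refine fun x => (hU x).trans ⟨fun h => h.2, fun h => ⟨?_, h⟩⟩
    obtain ⟨n, A, h1, h2⟩ := h
    exact (hp x).2 ((hmem n A h1).2.1 x h2)
  refine ⟨U, hU', ?_⟩
  obtain ⟨e, he⟩ := hTD.exists_enumeration_union
    (A := fun n x => ∃ A, App F n.1 A ∧ x.1 ∈ₘ A) (by fun_prop) fun n => by
      obtain ⟨A, hA, hA'⟩ := hF.2 n.1 ((hw n.1).2 n.2)
      obtain ⟨e, he⟩ := (hmem n.1 A hA).2.2.exists_enumeration
      -- F is single-valued, so B is the set A whose enumeration e was obtained.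
      refine ⟨e, fun x ⟨B, hB, hx⟩ => he x ?_⟩
      rwa [← hA' B hB]
  refine isCountable_of_enumeration (fun x hx => (hp x).1 ((hU x).1 hx).1) (e := e) fun x hx => ?_
  obtain ⟨n, A, h1, h2⟩ := (hU' x.1).1 hx
  exact he ⟨n, (hmem n A h1).1⟩ x ⟨A, h1, h2⟩
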